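/- Let $(K_1,d_{K_1}),\dots,(K_n,d_{K_n})$ be nonempty complete separable metric spaces of diameter at most $1$, let $\lambda_i$ be a Borel probability measure on $K_i$ for each $i$, and let $f:\prod_{i=1}^n K_i\to\mathbb{R}$ be bounded and continuous. For a bounded continuous function $g$ on $\prod_i K_i$ let $\xi_g$ be its Gibbs measure, $\xi_g(d\mathbf{x})=\frac{1}{Z_g}e^{g(\mathbf{x})}\prod_i\lambda_i(dx_i)$ with $Z_g=\int e^{g}\,d(\lambda_1\times\cdots\times\lambda_n)$, and let $\mu=\xi_f$. Fix reference points $*_i\in K_i$ and put, for $\mathbf{x},\mathbf{y}\in\prod_iK_i$, $$\nabla f(\mathbf{x},\mathbf{y})=\sum_{i=1}^n\Big(f(x_1,\dots,x_{i-1},y_i,x_{i+1},\dots,x_n)-f(x_1,\dots,x_{i-1},*_i,x_{i+1},\dots,x_n)\Big).$$ Let $d_n(\mathbf{x},\mathbf{y})=\frac1n\sum_i d_{K_i}(x_i,y_i)$ and, for probability measures $\nu,\nu'$ on $\prod_iK_i$, let $\overline{d_n}(\nu,\nu')=\inf_\gamma\int d_n\,d\gamma$, the infimum being over all couplings $\gamma$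 of $\nu$ and $\nu'$. For finite-valued random variables let $$\mathrm{DTC}(X_1,\dots,X_n)=\mathrm{H}(X_1,\dots,X_n)-\sum_{i=1}^n\mathrm{H}(X_i\mid (X_j)_{j\ne i}),$$ where $\mathrm H$ denotes Shannon entropy (natural logarithm), and let $\mathrm{DTC}(\mu)$ be the supremum, over all tuples of finite measurable partitions $\mathcal{Q}_i$ of $K_i$, of the $\mathrm{DTC}$ of the coordinates $x_1,\dots,x_n$ under $\mu$ quantized by $\mathcal{Q}_1,\dots,\mathcal{Q}_n$. Let $\mathrm D(\cdot\,\|\,\cdot)$ denote Kullback--Leibler divergence. Let $\mathcal{P}$ be a countable (for example, finite) measurable partition of $\prod_iK_i$ whose Shannon entropy $\mathrm{H}_\mu(\mathcal{P})=-\sum_{P\in\mathcal{P}}\mu(P)\log\mu(P)$ is finite (this is automatic if $\mathcal{P}$ is finite), and let $\delta\in\mathbb{R}$ be such that $$\sup_{\mathbf{z}}|\nabla f(\mathbf{x},\mathbf{z})-\nabla f(\mathbf{y},\mathbf{z})|<\delta n\qquad\text{whenever }\mathbf{x},\mathbf{y}\text{ lie in the same part of }\mathcal{P}.$$ Write $\mu_{|P}=\mu(\,\cdot\mid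 P)$; parts $P$ with $\mu(P)=0$ contribute $0$ to the sums below. Then: (a) $\mathrm{DTC}(\mu)<\mathrm{H}_\mu(\mathcal{P})+\delta n$; (b) $\displaystyle\sum_{P\in\mathcal{P}}\mu(P)\int \mathrm{D}\big(\mu_{|P}\,\big\|\,\xi_{\nabla f(\mathbf{y},\cdot)}\big)\,\mu_{|P}(d\mathbf{y})<\mathrm{H}_\mu(\mathcal{P})+\delta n$; (c) $\displaystyle\sum_{P\in\mathcal{P}}\mu(P)\int \overline{d_n}\big(\mu_{|P},\xi_{\nabla f(\mathbf{y},\cdot)}\big)\,\mu_{|P}(d\mathbf{y})<\sqrt{\tfrac12\Big(\frac{\mathrm{H}_\mu(\mathcal{P})}{n}+\delta\Big)}$. -/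

import Mathlib

open MeasureTheory ProbabilityTheory InformationTheory
open scoped ENNReal BoundedContinuousFunction

namespace GibbsMixture

noncomputable section

/-! ### Gibbs measures and discrete gradients -/

/-- The Gibbs measure on `∏ i, K i` with potential `g` and reference measures `lam i`:
the measure `Z⁻¹ exp (g x) ∏ i, lam i (dx i)`, where `Z = ∫ exp g d(∏ i, lam i)`. -/
def gibbs {n : ℕ} {K : Fin n → Type*} [∀ i, MeasurableSpace (K i)]
    (lam : ∀ i, Measure (K i)) (g : (∀ i, K i) → ℝ) : Measure (∀ i, K i) :=
  (Measure.pi lam).tilted g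

/-- The discrete partial derivative `∂ᵢ f (x, y)` relative to the reference point `star`. -/
def discretePartial {n : ℕ} {K : Fin n → Type*} (star : ∀ i, K i)
    (f : (∀ i, K i) → ℝ) (i : Fin n) (x : ∀ i, K i) (y : K i) : ℝ :=
  f (Function.update x i y) - f (Function.update x i (star i))

/-- The discrete gradient `∇f (x, y) = ∑ i, ∂ᵢ f (x, y i)`. -/
def discreteGradient {n : ℕ} {K : Fin n → Type*} (star : ∀ i, K i)
    (f : (∀ i, K i) → ℝ) (x y : ∀ i, K i) : ℝ :=
  ∑ i, discretePartial star f i x (y i)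

/-! ### Transportation metric -/

/-- The normalized Hamming average `(1 / n) ∑ i, d (x i, y i)` of the metrics. -/
def hammingAverage {n : ℕ} {K : Fin n → Type*} [∀ i, MetricSpace (K i)]
    (x y : ∀ i, K i) : ℝ :=
  (∑ i, dist (x i) (y i)) / n

/-- The transportation distance over `hammingAverage`: the infimum over all couplings `γ` of
`μ` and `ν` of the integral of the normalized Hamming average. -/
def transportDist {n : ℕ} {K : Fin n → Type*} [∀ i, MetricSpace (K i)]
    [∀ i, MeasurableSpace (K i)] (μ ν : Measure (∀ i, K i)) : ℝ≥0∞ :=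
  ⨅ (γ : Measure ((∀ i, K i) × (∀ i, K i))) (_ : γ.fst = μ ∧ γ.snd = ν),
    ∫⁻ z, ENNReal.ofReal (hammingAverage z.1 z.2) ∂γ

/-! ### Shannon entropy and dual total correlation -/

/-- The Shannon entropy `-∑ P, μ(P) log μ(P)` of a family `parts` of sets (a countable measurable
partition in the applications), as an extended nonnegative number. -/
def partitionEntropy {Ω : Type*} [MeasurableSpace Ω] (μ : Measure Ω) (parts : Set (Set Ω)) : ℝ≥0∞ :=
  ∑' P : parts, ENNReal.ofReal (Real.negMulLog (μ.real (P : Set Ω)))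

/-- The Shannon entropy of a finite-valued random variable. -/
def entropy {Ω α : Type*} [MeasurableSpace Ω] [Fintype α] (μ : Measure Ω) (X : Ω → α) : ℝ :=
  ∑ a, Real.negMulLog (μ.real (X ⁻¹' {a}))

/-- The conditional Shannon entropy `H(X | Y) = ∑ b, ℙ(Y = b) H(X | Y = b)` of finite-valued
random variables. -/
def condEntropy {Ω α β : Type*} [MeasurableSpace Ω] [Fintype α] [Fintype β] (μ : Measure Ω)
    (X : Ω → α) (Y : Ω → β) : ℝ :=
  ∑ b, μ.real (Y ⁻¹' {b}) * entropy (μ[|Y ⁻¹' {b}]) X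

/-- The dual total correlation of finite-valued random variables:
`H(X₁, …, Xₙ) - ∑ i, H(Xᵢ | (Xⱼ)_{j ≠ i})`. -/
def finiteDTC {n : ℕ} {Ω : Type*} [MeasurableSpace Ω] {α : Fin n → Type*} [∀ i, Fintype (α i)]
    (μ : Measure Ω) (X : ∀ i, Ω → α i) : ℝ :=
  entropy μ (fun ω i => X i ω) -
    ∑ i, condEntropy μ (X i) (fun ω (j : {j : Fin n // j ≠ i}) => X j ω)

/-- The dual total correlation of a measure on `∏ i, K i`, that is, of the coordinate variables
under it: the supremum of the dual total correlations of all their quantizations by finite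
measurable partitions of the spaces `K i`. A finite measurable partition of `K i` into at most
`k i` parts is given by its quantization map `q i : K i → Fin (k i)`. -/
def DTC {n : ℕ} {K : Fin n → Type*} [∀ i, MeasurableSpace (K i)]
    (μ : Measure (∀ i, K i)) : EReal :=
  ⨆ (k : Fin n → ℕ) (q : ∀ i, K i → Fin (k i)) (_ : ∀ i, Measurable (q i)),
    ((finiteDTC μ (fun i x => q i (x i)) : ℝ) : EReal)

end

end GibbsMixture

/-!
Write `ξ` for the product of the reference measures, `p` for the density of the Gibbs measure `μ`
with respect to `ξ`, `h(g) = ∫ g log g dξ`, and `Eᵢ` for averaging over the `i`-th coordinate.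

**Dual total correlation.** The dual total correlation of the law with density `g` is
`Φ(g) = (n - 1) h(g) - ∑ i, h(Eᵢ g)`. Quantizing one coordinate replaces `g` by its average `A g`
over the cells of that coordinate. It decreases `Φ`, by strong subadditivity
(`entropyInt_submodular`): `h(g) - h(A g) ≥ h(Eᵢ g) - h(Eᵢ A g)`. Once all coordinates are
quantized, `Φ` is the dual total correlation of finite-valued random variables, so `DTC(μ) ≤ Φ(p)`
(`finiteDTC_le`), and `Φ(p) ≥ 0` follows from the trivial quantization.

**Gibbs measures.** The conditional law of one coordinate of `μ` given the others at `x` is a factor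
of the product measure `ξ_x`, the Gibbs measure of `∇f (x, ·)`. Hence `Φ(p) = -∫ T dμ` for
`T(x) = f(x) - log Z + log Z_x - ∇f (x, x)`, where `Z` and `Z_x` are the partition functions of `f`
and of `∇f (x, ·)` (`dtcFunctional_gibbs`). On a part `P` the density of `μ_{|P}` relative to
`ξ_y` is explicit, and averaging the divergence over `y` gives
`-log μ(P) + ∫ T dμ_{|P} + e_P` (`integral_condDivergence`), where `e_P` is the average of
`∇f (x, x) - ∇f (y, x)` over independent `x, y` with law `μ_{|P}`, so that `|e_P| < δ n`.
Summing over the partition, the sum of the divergences plus `Φ(p)` equals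
`H_μ(𝒫) + ∑ μ(P) e_P < H_μ(𝒫) + δ n` (`sum_divergence_add_dtcFunctional_lt`). Both terms on the left
are nonnegative, so each of them satisfies the bound.

**Transportation.** Since `ξ_y` is a product measure on spaces of diameter at most one, Marton's
inequality bounds the transportation distance of a measure of divergence `D` from it by
`√(D / (2 n))`. It is used in the form `D / (4 c n) + c / 2` for arbitrary `c > 0`
(`transportDist_densityMeasure_le`), which is linear in `D` and so can be summed over the partition
without a further appeal to concavity; the transportation bound is the choice
`c = √((H_μ(𝒫) / n + δ) / 2)` together with the bound on the sum of the divergences.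
Marton's inequality is proved by resampling the coordinates one at a time: each step costs at most
a total variation distance divided by `n`, which Pinsker's inequality bounds by the loss of `h`, and
the losses of `h` telescope.
-/


/-! ### Bounded measurable functions -/

namespace GibbsMixture

/-- Measurable real functions with bounded absolute value. -/
def BoundedMeasurable {Ω : Type*} [MeasurableSpace Ω] (g : Ω → ℝ) : Prop :=
  Measurable g ∧ ∃ C, ∀ x, |g x| ≤ C

namespace BoundedMeasurable

variable {Ω Ω' : Type*} [MeasurableSpace Ω] [MeasurableSpace Ω'] {g h : Ω → ℝ}

theorem integrable (hg : BoundedMeasurable g) (μ : Measure Ω) [IsFiniteMeasure μ] :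
    Integrable g μ := by
  obtain ⟨hm, C, hC⟩ := hg
  exact Integrable.of_bound hm.aestronglyMeasurable C (Filter.Eventually.of_forall hC)

theorem const (c : ℝ) : BoundedMeasurable (fun _ : Ω => c) :=
  ⟨measurable_const, |c|, fun _ => le_rfl⟩

theorem comp_measurable (hg : BoundedMeasurable g) {T : Ω' → Ω} (hT : Measurable T) :
    BoundedMeasurable (fun x => g (T x)) :=
  ⟨hg.1.comp hT, hg.2.choose, fun x => hg.2.choose_spec (T x)⟩

theorem comp_continuous (hg : BoundedMeasurable g) {φ : ℝ → ℝ} (hφ : Continuous φ) :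
    BoundedMeasurable (fun x => φ (g x)) := by
  obtain ⟨hm, C, hC⟩ := hg
  refine ⟨hφ.measurable.comp hm, ?_⟩
  obtain ⟨D, hD⟩ := (isCompact_Icc (a := -C) (b := C)).exists_bound_of_continuousOn hφ.continuousOn
  exact ⟨D, fun x => hD _ (abs_le.1 (hC x))⟩

theorem add (hg : BoundedMeasurable g) (hh : BoundedMeasurable h) :
    BoundedMeasurable (fun x => g x + h x) := by
  obtain ⟨hm, C, hC⟩ := hg
  obtain ⟨hm', C', hC'⟩ := hh
  exact ⟨hm.add hm', C + C', fun x => (abs_add_le _ _).trans (add_le_add (hC x) (hC' x))⟩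

theorem mul (hg : BoundedMeasurable g) (hh : BoundedMeasurable h) :
    BoundedMeasurable (fun x => g x * h x) := by
  obtain ⟨hm, C, hC⟩ := hg
  obtain ⟨hm', C', hC'⟩ := hh
  refine ⟨hm.mul hm', C * C', fun x => ?_⟩
  rw [abs_mul]
  exact mul_le_mul (hC x) (hC' x) (abs_nonneg _) ((abs_nonneg _).trans (hC x))

theorem neg (hg : BoundedMeasurable g) : BoundedMeasurable (fun x => -g x) :=
  hg.comp_continuous continuous_neg

theorem sub (hg : BoundedMeasurable g) (hh : BoundedMeasurable h) :
    BoundedMeasurable (fun x => g x - h x) := by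
  simpa only [sub_eq_add_neg] using hg.add hh.neg

theorem sum {κ : Type*} (s : Finset κ) {g : κ → Ω → ℝ}
    (hg : ∀ i ∈ s, BoundedMeasurable (g i)) : BoundedMeasurable (fun x => ∑ i ∈ s, g i x) := by
  classical
  induction s using Finset.induction_on with
  | empty => simpa using const 0
  | insert a s ha ih =>
    simp only [Finset.sum_insert ha]
    exact (hg a (Finset.mem_insert_self _ _)).add
      (ih fun i hi => hg i (Finset.mem_insert_of_mem hi))

theorem of_bounds (hm : Measurable g) {a b : ℝ} (ha : ∀ x, a ≤ g x) (hb : ∀ x, g x ≤ b) :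
    BoundedMeasurable g :=
  ⟨hm, max |a| |b|, fun x => abs_le_max_abs_abs (ha x) (hb x)⟩

theorem log (hg : BoundedMeasurable g) {c : ℝ} (hc : 0 < c) (h : ∀ x, c ≤ g x) :
    BoundedMeasurable (fun x => Real.log (g x)) := by
  obtain ⟨hm, C, hC⟩ := hg
  exact of_bounds (Real.measurable_log.comp hm) (fun x => Real.log_le_log hc (h x))
    (fun x => Real.log_le_log (hc.trans_le (h x)) ((le_abs_self _).trans (hC x)))

theorem inv (hg : BoundedMeasurable g) {c : ℝ} (hc : 0 < c) (h : ∀ x, c ≤ g x) :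
    BoundedMeasurable (fun x => (g x)⁻¹) :=
  of_bounds hg.1.inv (fun x => (inv_pos.2 (hc.trans_le (h x))).le)
    (fun x => inv_anti₀ hc (h x))

theorem integral_prod_right {F : Ω × Ω' → ℝ} (hF : BoundedMeasurable F)
    (μ : Measure Ω') [IsProbabilityMeasure μ] : BoundedMeasurable (fun x => ∫ y, F (x, y) ∂μ) := by
  obtain ⟨hm, C, hC⟩ := hF
  refine ⟨(hm.stronglyMeasurable.integral_prod_right' (ν := μ)).measurable, C, fun x => ?_⟩
  have h := norm_integral_le_of_norm_le_const (μ := μ) (f := fun y => F (x, y)) (C := C)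
    (Filter.Eventually.of_forall fun y => hC (x, y))
  simpa using h

end BoundedMeasurable

/-! ### Resampling one coordinate of a product measure -/

section Average

variable {ι : Type*} [Fintype ι] [DecidableEq ι] {K : ι → Type*} [∀ i, MeasurableSpace (K i)]
  (lam : ∀ i, Measure (K i)) [∀ i, IsProbabilityMeasure (lam i)] (i : ι)

theorem measurePreserving_update :
    MeasurePreserving (fun z : (∀ j, K j) × K i => Function.update z.1 i z.2)
      ((Measure.pi lam).prod (lam i)) (Measure.pi lam) := by
  refine ⟨measurable_update', (Measure.pi_eq fun s hs => ?_).symm⟩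
  have hpre : (fun z : (∀ j, K j) × K i => Function.update z.1 i z.2) ⁻¹' (Set.univ.pi s)
      = (Set.univ.pi (Function.update s i Set.univ)) ×ˢ s i := by
    ext ⟨x, y⟩
    simp only [Set.mem_preimage, Set.mem_pi, Set.mem_univ, true_imp_iff, Set.mem_prod]
    constructor
    · intro h
      refine ⟨fun j => ?_, by simpa using h i⟩
      rcases eq_or_ne j i with rfl | hj
      · simp
      · simpa [hj] using h j
    · rintro ⟨h, hy⟩ j
      rcases eq_or_ne j i with rfl | hj
      · simpa using hy
      · simpa [hj] using h j
  rw [Measure.map_apply measurable_update' (MeasurableSet.univ_pi hs), hpre, Measure.prod_prod,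
    Measure.pi_pi, ← Finset.mul_prod_erase Finset.univ _ (Finset.mem_univ i),
    ← Finset.mul_prod_erase Finset.univ (fun j => lam j (s j)) (Finset.mem_univ i)]
  simp only [Function.update_self, measure_univ, one_mul]
  rw [mul_comm]
  congr 1
  refine Finset.prod_congr rfl fun j hj => ?_
  rw [Function.update_of_ne (Finset.ne_of_mem_erase hj)]

theorem lintegral_update {F : (∀ j, K j) → ℝ≥0∞} (hF : Measurable F) :
    ∫⁻ x, ∫⁻ y, F (Function.update x i y) ∂lam i ∂Measure.pi lam = ∫⁻ x, F x ∂Measure.pi lam := by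
  have h : Measurable fun z : (∀ j, K j) × K i => F (Function.update z.1 i z.2) :=
    hF.comp measurable_update'
  rw [← (measurePreserving_update lam i).lintegral_comp hF, lintegral_prod _ h.aemeasurable]

/-- Exchanging the `i`-th coordinate with an independent copy leaves the product measure
invariant. -/
theorem lintegral_update_swap {F : (∀ j, K j) → K i → ℝ≥0∞} (hF : Measurable (Function.uncurry F)) :
    ∫⁻ x, ∫⁻ y, F (Function.update x i y) (x i) ∂lam i ∂Measure.pi lam
      = ∫⁻ x, ∫⁻ y, F x y ∂lam i ∂Measure.pi lam := by
  have h1 : Measurable fun x => ∫⁻ y, F (Function.update x i y) (x i) ∂lam i :=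
    (hF.comp (measurable_update'.prodMk
      ((measurable_pi_apply i).comp measurable_fst))).lintegral_prod_right'
  have h2 : Measurable fun x => ∫⁻ y, F x y ∂lam i := hF.lintegral_prod_right'
  rw [← lintegral_update lam i h1, ← lintegral_update lam i h2]
  refine lintegral_congr fun x => ?_
  simp only [Function.update_idem, Function.update_self]
  refine lintegral_lintegral_swap ?_
  refine (hF.comp (Measurable.prodMk ?_ measurable_fst)).aemeasurable
  exact measurable_update'.comp (measurable_const.prodMk measurable_snd)

theorem integral_update {F : (∀ j, K j) → ℝ} (hF : BoundedMeasurable F) :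
    ∫ x, ∫ y, F (Function.update x i y) ∂lam i ∂Measure.pi lam = ∫ x, F x ∂Measure.pi lam := by
  have h := hF.comp_measurable
    (measurable_update' (a := i) : Measurable fun z : (∀ j, K j) × K i => _)
  have hmp := measurePreserving_update lam i
  conv_rhs => rw [← hmp.map_eq]
  rw [integral_map hmp.measurable.aemeasurable hF.1.aestronglyMeasurable,
    integral_prod _ (h.integrable _)]

/-! ### Averaging over the cells of a quantization -/

/-- A function on the product which does not change when its `i`-th coordinate moves inside a
cell of the quantization map `r`. -/
def CellInvariant {β : Type*} (r : K i → β) (φ : (∀ j, K j) → ℝ) : Prop :=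
  ∀ x y, r y = r (x i) → φ (Function.update x i y) = φ x

/-- The average of `g` over the `i`-th coordinate, conditionally on the cell `r (x i)`. -/
noncomputable def cellAverage {β : Type*} (r : K i → β) (g : (∀ j, K j) → ℝ) (x : ∀ j, K j) : ℝ :=
  ∫ y, g (Function.update x i y) ∂(lam i)[|r ⁻¹' {r (x i)}]

/-- The average of `g` over the `i`-th coordinate. -/
noncomputable abbrev coordAverage (g : (∀ j, K j) → ℝ) : (∀ j, K j) → ℝ :=
  cellAverage lam i (fun _ => ()) g

omit [Fintype ι] in
theorem coordAverage_apply (g : (∀ j, K j) → ℝ) (x : ∀ j, K j) :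
    coordAverage lam i g x = ∫ y, g (Function.update x i y) ∂lam i := by
  simp [coordAverage, cellAverage]

/-- A quantization map with finitely many values, none of whose nonempty cells is null. -/
structure GoodQuantizer {X β : Type*} [MeasurableSpace X] [MeasurableSpace β]
    (m : Measure X) (r : X → β) : Prop where
  measurable : Measurable r
  ne_zero : ∀ y, m (r ⁻¹' {r y}) ≠ 0

theorem goodQuantizer_const {X : Type*} [MeasurableSpace X] (m : Measure X)
    [IsProbabilityMeasure m] : GoodQuantizer m (fun _ : X => ()) :=
  ⟨measurable_const, by simp⟩

/-- Averaging over cells does not change the pairing with a function constant on cells. -/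
theorem integral_cond_mul {X β : Type*} [MeasurableSpace X] [Fintype β] [MeasurableSpace β]
    [MeasurableSingletonClass β] (m : Measure X) [IsProbabilityMeasure m] {r : X → β}
    (hr : Measurable r) {u φ : X → ℝ} (hu : BoundedMeasurable u) (hφ : BoundedMeasurable φ)
    (hinv : ∀ y z, r y = r z → φ y = φ z) :
    ∫ y, (∫ z, u z ∂m[|r ⁻¹' {r y}]) * φ y ∂m = ∫ y, u y * φ y ∂m := by
  have hcell : ∀ b, MeasurableSet (r ⁻¹' {b}) := fun b => hr (measurableSet_singleton b)
  have hU : (⋃ b, r ⁻¹' {b}) = Set.univ := by ext y; simp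
  have hd : Pairwise (Function.onFun Disjoint fun b => r ⁻¹' {b}) := fun b b' hb =>
    Disjoint.preimage r (by simpa using hb)
  have hG : BoundedMeasurable (fun y => ∫ z, u z ∂m[|r ⁻¹' {r y}]) := by
    refine ⟨(measurable_of_finite fun b => ∫ z, u z ∂m[|r ⁻¹' {b}]).comp hr,
      ∑ b, |∫ z, u z ∂m[|r ⁻¹' {b}]|, fun y => ?_⟩
    exact Finset.single_le_sum (f := fun b => |∫ z, u z ∂m[|r ⁻¹' {b}]|)
      (fun _ _ => abs_nonneg _) (Finset.mem_univ (r y))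
  rw [← setIntegral_univ (μ := m), ← setIntegral_univ (μ := m), ← hU,
    integral_iUnion_fintype hcell hd fun b => ((hG.mul hφ).integrable m).integrableOn,
    integral_iUnion_fintype hcell hd fun b => ((hu.mul hφ).integrable m).integrableOn]
  refine Finset.sum_congr rfl fun b _ => ?_
  rcases (r ⁻¹' {b}).eq_empty_or_nonempty with he | ⟨y₀, hy₀⟩
  · simp [he]
  · have h1 : ∀ y ∈ r ⁻¹' {b}, (∫ z, u z ∂m[|r ⁻¹' {r y}]) * φ y
        = (∫ z, u z ∂m[|r ⁻¹' {b}]) * φ y₀ := by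
      intro y hy
      rw [show r y = b from hy, hinv y y₀ (hy.trans hy₀.symm)]
    have h2 : ∀ y ∈ r ⁻¹' {b}, u y * φ y = u y * φ y₀ := by
      intro y hy
      rw [hinv y y₀ (hy.trans hy₀.symm)]
    rw [setIntegral_congr_fun (hcell b) h1, setIntegral_congr_fun (hcell b) h2,
      setIntegral_const, integral_mul_const]
    simp only [ProbabilityTheory.cond, integral_smul_measure, smul_eq_mul, ENNReal.toReal_inv]
    rw [← mul_assoc, ← mul_assoc]
    by_cases h0 : m (r ⁻¹' {b}) = 0
    · simp [Measure.restrict_eq_zero.2 h0, measureReal_def, h0]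
    · congr 1
      rw [measureReal_def, mul_inv_cancel₀ (ENNReal.toReal_ne_zero.2 ⟨h0, measure_ne_top _ _⟩),
        one_mul]

variable {i} {β : Type*} [MeasurableSpace β] {r : K i → β} {g φ : (∀ j, K j) → ℝ}

omit [Fintype ι] [∀ i, MeasurableSpace (K i)] [MeasurableSpace β] in
theorem CellInvariant.comp (hφ : CellInvariant i r φ) (F : ℝ → ℝ) :
    CellInvariant i r (fun x => F (φ x)) := fun x y h => by simp only [hφ x y h]

omit [Fintype ι] [∀ i, MeasurableSpace (K i)] [MeasurableSpace β] in
theorem CellInvariant.mul (hφ : CellInvariant i r φ) (hg : CellInvariant i r g) :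
    CellInvariant i r (fun x => φ x * g x) := fun x y h => by simp only [hφ x y h, hg x y h]

omit [Fintype ι] [∀ i, IsProbabilityMeasure (lam i)] [MeasurableSpace β] in
theorem cellInvariant_cellAverage (g : (∀ j, K j) → ℝ) :
    CellInvariant i r (cellAverage lam i r g) := fun x y h => by
  simp [cellAverage, h]

omit [Fintype ι] [∀ i, IsProbabilityMeasure (lam i)] [MeasurableSpace β] in
theorem CellInvariant.cellAverage_of_ne {j : ι} {γ : Type*} {s : K j → γ} (hji : j ≠ i)
    (hg : CellInvariant j s g) : CellInvariant j s (cellAverage lam i r g) := fun x y h => by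
  simp only [cellAverage]
  rw [Function.update_of_ne hji.symm]
  refine integral_congr_ae (Filter.Eventually.of_forall fun z => ?_)
  simp only
  rw [Function.update_comm hji]
  exact hg _ _ (by rwa [Function.update_of_ne hji])

omit [Fintype ι] [∀ i, MeasurableSpace (K i)] [MeasurableSpace β] in
theorem CellInvariant.of_coord (hφ : CellInvariant i (fun _ => ()) φ) : CellInvariant i r φ :=
  fun x y _ => hφ x y rfl

omit [Fintype ι] [DecidableEq ι] in
theorem GoodQuantizer.isProbabilityMeasure (hr : GoodQuantizer (lam i) r) (y : K i) :
    IsProbabilityMeasure ((lam i)[|r ⁻¹' {r y}]) :=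
  cond_isProbabilityMeasure (hr.ne_zero y)

omit [Fintype ι] in
theorem boundedMeasurable_update (hg : BoundedMeasurable g) (x : ∀ j, K j) :
    BoundedMeasurable (fun y => g (Function.update x i y)) :=
  hg.comp_measurable (measurable_update x)

omit [Fintype ι] in
theorem le_cellAverage (hr : GoodQuantizer (lam i) r) (hg : BoundedMeasurable g) {c : ℝ}
    (hc : ∀ x, c ≤ g x) (x : ∀ j, K j) : c ≤ cellAverage lam i r g x := by
  have := hr.isProbabilityMeasure lam (x i)
  simpa [cellAverage] using integral_mono (μ := (lam i)[|r ⁻¹' {r (x i)}]) (integrable_const c)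
    ((boundedMeasurable_update hg x).integrable _) fun y => hc _

omit [Fintype ι] in
theorem cellAverage_le (hr : GoodQuantizer (lam i) r) (hg : BoundedMeasurable g) {c : ℝ}
    (hc : ∀ x, g x ≤ c) (x : ∀ j, K j) : cellAverage lam i r g x ≤ c := by
  have := hr.isProbabilityMeasure lam (x i)
  simpa [cellAverage] using integral_mono (μ := (lam i)[|r ⁻¹' {r (x i)}])
    ((boundedMeasurable_update hg x).integrable _) (integrable_const c) fun y => hc _

variable [Fintype β] [MeasurableSingletonClass β]

omit [Fintype ι] in
theorem boundedMeasurable_cellAverage (hr : GoodQuantizer (lam i) r) (hg : BoundedMeasurable g) :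
    BoundedMeasurable (cellAverage lam i r g) := by
  have hb : Measurable (Function.uncurry fun (b : β) (x : ∀ j, K j) =>
      ∫ y, g (Function.update x i y) ∂(lam i)[|r ⁻¹' {b}]) := by
    refine measurable_from_prod_countable_right fun b => ?_
    have hgu : Measurable fun z : (∀ j, K j) × K i => g (Function.update z.1 i z.2) :=
      hg.1.comp measurable_update'
    exact (hgu.stronglyMeasurable.integral_prod_right' (ν := (lam i)[|r ⁻¹' {b}])).measurable
  have hr' : Measurable fun x : ∀ j, K j => (r (x i), x) :=
    (hr.measurable.comp (measurable_pi_apply i)).prodMk measurable_id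
  have hm : Measurable (cellAverage lam i r g) := by
    have h := hb.comp hr'
    simpa only [Function.comp_def, Function.uncurry_apply_pair, ← cellAverage.eq_1] using h
  obtain ⟨C, hC⟩ := hg.2
  exact BoundedMeasurable.of_bounds hm
    (le_cellAverage lam hr hg fun x => (abs_le.1 (hC x)).1)
    (cellAverage_le lam hr hg fun x => (abs_le.1 (hC x)).2)

theorem integral_cellAverage_mul (hr : GoodQuantizer (lam i) r) (hg : BoundedMeasurable g)
    (hφ : BoundedMeasurable φ) (hinv : CellInvariant i r φ) :
    ∫ x, cellAverage lam i r g x * φ x ∂Measure.pi lam = ∫ x, g x * φ x ∂Measure.pi lam := by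
  rw [← integral_update lam i ((boundedMeasurable_cellAverage lam hr hg).mul hφ),
    ← integral_update lam i (hg.mul hφ)]
  refine integral_congr_ae (Filter.Eventually.of_forall fun x => ?_)
  simp only
  rw [← integral_cond_mul (lam i) hr.measurable (boundedMeasurable_update hg x)
    (boundedMeasurable_update hφ x)]
  · simp [cellAverage]
  · intro y z hyz
    simpa using hinv (Function.update x i z) y (by simpa using hyz)

theorem integral_cellAverage (hr : GoodQuantizer (lam i) r) (hg : BoundedMeasurable g) :
    ∫ x, cellAverage lam i r g x ∂Measure.pi lam = ∫ x, g x ∂Measure.pi lam := by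
  simpa using integral_cellAverage_mul lam hr hg (BoundedMeasurable.const 1) fun _ _ _ => rfl

omit [Fintype ι] in
theorem coordAverage_cellAverage (hr : GoodQuantizer (lam i) r) (hg : BoundedMeasurable g) :
    coordAverage lam i (cellAverage lam i r g) = coordAverage lam i g := by
  funext x
  rw [coordAverage_apply, coordAverage_apply]
  have := integral_cond_mul (lam i) hr.measurable (boundedMeasurable_update hg x)
    (BoundedMeasurable.const 1) fun _ _ _ => rfl
  simpa [cellAverage] using this

end Average

end GibbsMixture

/-! ### Submodularity of the entropy integral -/

namespace GibbsMixture

section Entropy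

variable {ι : Type*} [Fintype ι] [DecidableEq ι] {K : ι → Type*} [∀ i, MeasurableSpace (K i)]
  (lam : ∀ i, Measure (K i)) [∀ i, IsProbabilityMeasure (lam i)]

/-- The integral `∫ g log g` against the product measure. For a probability density `g` it is the
relative entropy of the measure with density `g`. -/
noncomputable def entropyInt (g : (∀ j, K j) → ℝ) : ℝ :=
  ∫ x, g x * Real.log (g x) ∂Measure.pi lam

/-- The dual total correlation of the measure with density `g` relative to the product measure,
written as `(n - 1) h(g) - ∑ i, h(Eᵢ g)` where `h` is `entropyInt` and `Eᵢ` averages over the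
`i`-th coordinate. -/
noncomputable def dtcFunctional (g : (∀ j, K j) → ℝ) : ℝ :=
  (Fintype.card ι - 1) * entropyInt lam g - ∑ i, entropyInt lam (coordAverage lam i g)

variable {lam} {i k : ι} {β : Type*} [MeasurableSpace β] [Fintype β] [MeasurableSingletonClass β]
  {r : K k → β} {g φ : (∀ j, K j) → ℝ} {c : ℝ}

/-- The entropy integral of a cell average, as a pairing with the original function. -/
theorem entropyInt_cellAverage (hr : GoodQuantizer (lam k) r) (hg : BoundedMeasurable g)
    (hc : 0 < c) (hcg : ∀ x, c ≤ g x) :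
    entropyInt lam (cellAverage lam k r g)
      = ∫ x, g x * Real.log (cellAverage lam k r g x) ∂Measure.pi lam :=
  integral_cellAverage_mul lam hr hg
    ((boundedMeasurable_cellAverage lam hr hg).log hc (le_cellAverage lam hr hg hcg))
    ((cellInvariant_cellAverage lam g).comp Real.log)

/-- Strong subadditivity: averaging over cells of one coordinate decreases the entropy integral
of `g` at least as much as that of the average of `g` over another coordinate. It is the
nonnegativity of the divergence of `g` from `A g * E g / E A g`, where `A` and `E` denote the two
averages; that function has the same integral as `g`. -/
theorem entropyInt_submodular (hr : GoodQuantizer (lam k) r) (hg : BoundedMeasurable g)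
    (hc : 0 < c) (hcg : ∀ x, c ≤ g x) (hik : k ≠ i) :
    entropyInt lam (cellAverage lam k r g) + entropyInt lam (coordAverage lam i g)
      ≤ entropyInt lam g + entropyInt lam (coordAverage lam i (cellAverage lam k r g)) := by
  have he := goodQuantizer_const (lam i)
  set A := cellAverage lam k r g with hA
  set E := coordAverage lam i g with hE
  set D := coordAverage lam i A with hD
  have bA : BoundedMeasurable A := boundedMeasurable_cellAverage lam hr hg
  have bE : BoundedMeasurable E := boundedMeasurable_cellAverage lam he hg
  have bD : BoundedMeasurable D := boundedMeasurable_cellAverage lam he bA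
  have cA : ∀ x, c ≤ A x := le_cellAverage lam hr hg hcg
  have cE : ∀ x, c ≤ E x := le_cellAverage lam he hg hcg
  have cD : ∀ x, c ≤ D x := le_cellAverage lam he bA cA
  have hDlog : entropyInt lam D = ∫ x, g x * Real.log (D x) ∂Measure.pi lam := by
    rw [hD, entropyInt_cellAverage he bA hc cA, ← hD]
    exact integral_cellAverage_mul lam hr hg (bD.log hc cD)
      (((cellInvariant_cellAverage lam g).cellAverage_of_ne lam hik).comp Real.log)
  have hint : ∫ x, A x * (E x * (D x)⁻¹) ∂Measure.pi lam = ∫ x, g x ∂Measure.pi lam := by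
    have hinv : CellInvariant i (fun _ => ()) fun x => E x * (D x)⁻¹ :=
      (cellInvariant_cellAverage lam g).mul ((cellInvariant_cellAverage lam A).comp _)
    rw [← integral_cellAverage_mul lam he bA (bE.mul (bD.inv hc cD)) hinv,
      ← integral_cellAverage lam he hg]
    refine integral_congr_ae (Filter.Eventually.of_forall fun x => ?_)
    have := (hc.trans_le (cD x)).ne'
    change D x * (E x * (D x)⁻¹) = E x
    field_simp
  have hpt : ∀ x, g x - A x * (E x * (D x)⁻¹) ≤ g x * Real.log (g x) + g x * Real.log (D x)
      - (g x * Real.log (A x) + g x * Real.log (E x)) := by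
    intro x
    have pg := hc.trans_le (hcg x)
    have pA := hc.trans_le (cA x)
    have pE := hc.trans_le (cE x)
    have pD := hc.trans_le (cD x)
    have h1 := Real.log_le_sub_one_of_pos (x := A x * (E x * (D x)⁻¹) / g x) (by positivity)
    rw [Real.log_div (by positivity) pg.ne', Real.log_mul pA.ne' (by positivity),
      Real.log_mul pE.ne' (by positivity), Real.log_inv] at h1
    have h2 := mul_le_mul_of_nonneg_left h1 pg.le
    have h3 : g x * (A x * (E x * (D x)⁻¹) / g x - 1) = A x * (E x * (D x)⁻¹) - g x := by
      field_simp
    rw [h3] at h2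
    linarith
  have b1 := hg.mul (hg.log hc hcg)
  have b2 := hg.mul (bD.log hc cD)
  have b3 := hg.mul (bA.log hc cA)
  have b4 := hg.mul (bE.log hc cE)
  have b5 := bA.mul (bE.mul (bD.inv hc cD))
  have hmono := integral_mono (μ := Measure.pi lam) ((hg.sub b5).integrable _)
    (((b1.add b2).sub (b3.add b4)).integrable _) hpt
  rw [integral_sub (hg.integrable _) (b5.integrable _), hint, sub_self,
    integral_sub ((b1.add b2).integrable _) ((b3.add b4).integrable _),
    integral_add (b1.integrable _) (b2.integrable _),
    integral_add (b3.integrable _) (b4.integrable _), ← hDlog,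
    ← entropyInt_cellAverage hr hg hc hcg, ← entropyInt_cellAverage he hg hc hcg] at hmono
  change 0 ≤ entropyInt lam g + _ - _ at hmono
  linarith

/-- The dual total correlation decreases when one coordinate is quantized. -/
theorem dtcFunctional_cellAverage_le (hr : GoodQuantizer (lam k) r) (hg : BoundedMeasurable g)
    (hc : 0 < c) (hcg : ∀ x, c ≤ g x) :
    dtcFunctional lam (cellAverage lam k r g) ≤ dtcFunctional lam g := by
  have hsum : ∑ i ∈ Finset.univ.erase k, (entropyInt lam (coordAverage lam i g)
      - entropyInt lam (coordAverage lam i (cellAverage lam k r g)))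
      ≤ ∑ i ∈ Finset.univ.erase k, (entropyInt lam g - entropyInt lam (cellAverage lam k r g)) := by
    refine Finset.sum_le_sum fun i hi => ?_
    have := entropyInt_submodular (i := i) hr hg hc hcg (Finset.ne_of_mem_erase hi).symm
    linarith
  rw [Finset.sum_const, Finset.card_erase_of_mem (Finset.mem_univ k), Finset.card_univ,
    nsmul_eq_mul, Nat.cast_sub (Fintype.card_pos_iff.2 ⟨k⟩), Nat.cast_one,
    Finset.sum_sub_distrib] at hsum
  unfold dtcFunctional
  rw [← Finset.add_sum_erase Finset.univ _ (Finset.mem_univ k),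
    ← Finset.add_sum_erase Finset.univ (fun i => entropyInt lam (coordAverage lam i g))
      (Finset.mem_univ k), coordAverage_cellAverage lam hr hg]
  linarith

/-- Quantizing all coordinates: there is a density `g` which is constant on product cells, has the
same integrals over product cells as `p`, and whose dual total correlation is at most that
of `p`. -/
theorem exists_quantized_density {α : ι → Type*} [∀ i, MeasurableSpace (α i)] [∀ i, Fintype (α i)]
    [∀ i, MeasurableSingletonClass (α i)] {q : ∀ i, K i → α i}
    (hq : ∀ i, GoodQuantizer (lam i) (q i)) {p : (∀ j, K j) → ℝ} (hp : BoundedMeasurable p)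
    (hc : 0 < c) (hcp : ∀ x, c ≤ p x) (S : Finset ι) :
    ∃ g, BoundedMeasurable g ∧ (∀ x, c ≤ g x) ∧ (∀ i ∈ S, CellInvariant i (q i) g) ∧
      (∀ φ, BoundedMeasurable φ → (∀ i, CellInvariant i (q i) φ) →
        ∫ x, g x * φ x ∂Measure.pi lam = ∫ x, p x * φ x ∂Measure.pi lam) ∧
      dtcFunctional lam g ≤ dtcFunctional lam p := by
  induction S using Finset.induction_on with
  | empty => exact ⟨p, hp, hcp, by simp, fun _ _ _ => rfl, le_rfl⟩
  | insert k S hk ih =>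
    obtain ⟨g, hg, hcg, hinv, hint, hle⟩ := ih
    refine ⟨cellAverage lam k (q k) g, boundedMeasurable_cellAverage lam (hq k) hg,
      le_cellAverage lam (hq k) hg hcg, fun i hi => ?_, fun φ hφ hφq => ?_,
      (dtcFunctional_cellAverage_le (hq k) hg hc hcg).trans hle⟩
    · rcases eq_or_ne i k with rfl | hik
      · exact cellInvariant_cellAverage lam g
      · exact (hinv i (Finset.mem_of_mem_insert_of_ne hi hik)).cellAverage_of_ne lam hik
    · rw [integral_cellAverage_mul lam (hq k) hg hφ (hφq k), hint φ hφ hφq]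

omit [∀ i, MeasurableSpace (K i)] in
theorem CellInvariant.eq_of_forall {α : ι → Type*} {q : ∀ i, K i → α i}
    (hg : ∀ i, CellInvariant i (q i) g) {x y : ∀ j, K j} (hxy : ∀ i, q i (y i) = q i (x i)) :
    g y = g x := by
  have key : ∀ S : Finset ι, g (S.piecewise y x) = g x := by
    intro S
    induction S using Finset.induction_on with
    | empty => simp
    | insert k S hk ih =>
      rw [Finset.piecewise_insert, hg k _ _ ?_, ih]
      rw [Finset.piecewise_eq_of_notMem _ _ _ hk, hxy k]
  simpa using key Finset.univ

end Entropy

end GibbsMixture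

/-! ### Entropy of finite-valued random variables -/

namespace GibbsMixture

section FiniteEntropy

variable {Ω : Type*} [MeasurableSpace Ω] {μ : Measure Ω} [IsProbabilityMeasure μ]
  {α β : Type*} [Fintype α] [Fintype β] [MeasurableSpace α] [MeasurableSpace β]
  [MeasurableSingletonClass α] [MeasurableSingletonClass β] {X X' : Ω → α} {Y Y' : Ω → β}

omit [IsProbabilityMeasure μ] [MeasurableSpace α] [MeasurableSingletonClass α] in
theorem entropy_congr (h : X =ᵐ[μ] X') : entropy μ X = entropy μ X' := by
  refine Finset.sum_congr rfl fun a _ => ?_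
  rw [measureReal_def, measureReal_def, measure_congr]
  filter_upwards [h] with ω hω
  exact congrArg (· = a) hω

omit [IsProbabilityMeasure μ] in
theorem integral_comp_fintype [IsFiniteMeasure μ] (hX : Measurable X) (F : α → ℝ) :
    ∫ ω, F (X ω) ∂μ = ∑ a, μ.real (X ⁻¹' {a}) * F a := by
  rw [← integral_map (φ := X) (f := F) hX.aemeasurable (measurable_of_finite F).aestronglyMeasurable,
    integral_fintype (.of_finite)]
  refine Finset.sum_congr rfl fun a _ => ?_
  rw [map_measureReal_apply hX (measurableSet_singleton a), smul_eq_mul]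

theorem entropy_eq_integral (hX : Measurable X) :
    entropy μ X = -∫ ω, Real.log (μ.real (X ⁻¹' {X ω})) ∂μ := by
  rw [integral_comp_fintype hX fun a => Real.log (μ.real (X ⁻¹' {a})), ← Finset.sum_neg_distrib]
  exact Finset.sum_congr rfl fun a _ => by simp [Real.negMulLog]

/-- The chain rule for Shannon entropy. -/
theorem condEntropy_eq_sub (hX : Measurable X) (hY : Measurable Y) :
    condEntropy μ X Y = entropy μ (fun ω => (X ω, Y ω)) - entropy μ Y := by
  simp only [condEntropy, entropy]
  rw [Fintype.sum_prod_type_right, ← Finset.sum_sub_distrib]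
  refine Finset.sum_congr rfl fun b _ => ?_
  have hpre : ∀ a, (fun ω => (X ω, Y ω)) ⁻¹' {(a, b)} = Y ⁻¹' {b} ∩ X ⁻¹' {a} := by
    intro a
    ext ω
    simp [and_comm]
  have hYb : MeasurableSet (Y ⁻¹' {b}) := hY (measurableSet_singleton b)
  have hsum : ∑ a, μ.real (Y ⁻¹' {b} ∩ X ⁻¹' {a}) = μ.real (Y ⁻¹' {b}) := by
    have h := integral_comp_fintype (μ := μ.restrict (Y ⁻¹' {b})) hX (fun _ => (1 : ℝ))
    simp only [integral_const, smul_eq_mul, mul_one, measureReal_restrict_apply_univ] at h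
    rw [h]
    refine Finset.sum_congr rfl fun a _ => ?_
    rw [measureReal_restrict_apply (hX (measurableSet_singleton a)), Set.inter_comm]
  have hcond : ∀ a, (μ[|Y ⁻¹' {b}]).real (X ⁻¹' {a})
      = (μ.real (Y ⁻¹' {b}))⁻¹ * μ.real (Y ⁻¹' {b} ∩ X ⁻¹' {a}) := by
    intro a
    simp only [measureReal_def, cond_apply hYb, ENNReal.toReal_mul, ENNReal.toReal_inv]
  simp only [hpre, hcond]
  rw [Finset.mul_sum, eq_sub_iff_add_eq]
  rcases eq_or_ne (μ.real (Y ⁻¹' {b})) 0 with h0 | h0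
  · have hz : ∀ a, μ.real (Y ⁻¹' {b} ∩ X ⁻¹' {a}) = 0 := fun a =>
      le_antisymm ((measureReal_mono Set.inter_subset_left).trans h0.le) measureReal_nonneg
    simp [h0, hz]
  · have : ∀ a, μ.real (Y ⁻¹' {b}) *
        Real.negMulLog ((μ.real (Y ⁻¹' {b}))⁻¹ * μ.real (Y ⁻¹' {b} ∩ X ⁻¹' {a}))
        = Real.negMulLog (μ.real (Y ⁻¹' {b} ∩ X ⁻¹' {a}))
          + μ.real (Y ⁻¹' {b} ∩ X ⁻¹' {a}) * Real.log (μ.real (Y ⁻¹' {b})) := by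
      intro a
      rw [Real.negMulLog_mul]
      simp only [Real.negMulLog, Real.log_inv]
      field_simp
      ring
    simp only [this]
    rw [Finset.sum_add_distrib, ← Finset.sum_mul, hsum, Real.negMulLog]
    ring

end FiniteEntropy

section DTC

variable {n : ℕ} {Ω : Type*} [MeasurableSpace Ω] {μ : Measure Ω} [IsProbabilityMeasure μ]
  {α : Fin n → Type*} [∀ i, Fintype (α i)] [∀ i, MeasurableSpace (α i)]
  [∀ i, MeasurableSingletonClass (α i)] {X X' : ∀ i, Ω → α i}

omit [∀ i, Fintype (α i)] [∀ i, MeasurableSingletonClass (α i)] in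
theorem measurable_rest (hX : ∀ i, Measurable (X i)) (i : Fin n) :
    Measurable (fun ω (j : {j : Fin n // j ≠ i}) => X j ω) :=
  measurable_pi_lambda _ fun j => hX j

theorem finiteDTC_congr (hX : ∀ i, Measurable (X i)) (hX' : ∀ i, Measurable (X' i))
    (h : ∀ i, X i =ᵐ[μ] X' i) : finiteDTC μ X = finiteDTC μ X' := by
  have hall : ∀ᵐ ω ∂μ, ∀ i, X i ω = X' i ω := ae_all_iff.2 h
  unfold finiteDTC
  refine congrArg₂ _ ?_ ?_
  · refine entropy_congr ?_
    filter_upwards [hall] with ω hω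
    funext i
    exact hω i
  · refine Finset.sum_congr rfl fun i _ => ?_
    rw [condEntropy_eq_sub (hX i) (measurable_rest hX i),
      condEntropy_eq_sub (hX' i) (measurable_rest hX' i)]
    congr 1
    · refine entropy_congr ?_
      filter_upwards [hall] with ω hω
      simp only [hω]
    · refine entropy_congr ?_
      filter_upwards [hall] with ω hω
      simp only [hω]

/-- The dual total correlation as an expectation of logarithms of probabilities of cells. -/
theorem finiteDTC_eq_integral (hX : ∀ i, Measurable (X i)) :
    finiteDTC μ X = (n - 1) * ∫ ω, Real.log (μ.real {ω' | ∀ j ∈ Finset.univ, X j ω' = X j ω}) ∂μ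
      - ∑ i, ∫ ω, Real.log (μ.real {ω' | ∀ j ∈ Finset.univ.erase i, X j ω' = X j ω}) ∂μ := by
  have hfull : entropy μ (fun ω i => X i ω)
      = -∫ ω, Real.log (μ.real {ω' | ∀ j ∈ Finset.univ, X j ω' = X j ω}) ∂μ := by
    rw [entropy_eq_integral (measurable_pi_lambda _ hX)]
    congr 2
    funext ω
    congr 2
    ext ω'
    simp [funext_iff]
  have hi : ∀ i, condEntropy μ (X i) (fun ω (j : {j : Fin n // j ≠ i}) => X j ω)
      = -∫ ω, Real.log (μ.real {ω' | ∀ j ∈ Finset.univ, X j ω' = X j ω}) ∂μ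
        + ∫ ω, Real.log (μ.real {ω' | ∀ j ∈ Finset.univ.erase i, X j ω' = X j ω}) ∂μ := by
    intro i
    rw [condEntropy_eq_sub (hX i) (measurable_rest hX i),
      entropy_eq_integral ((hX i).prodMk (measurable_rest hX i)),
      entropy_eq_integral (measurable_rest hX i), sub_neg_eq_add]
    congr 3
    · funext ω
      congr 2
      ext ω'
      simp only [Set.mem_preimage, Set.mem_singleton_iff, Prod.mk.injEq, funext_iff,
        Subtype.forall, Set.mem_ofPred_eq, Finset.mem_univ, true_imp_iff]
      refine ⟨fun h j => ?_, fun h => ⟨h i, fun j _ => h j⟩⟩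
      rcases eq_or_ne j i with rfl | hj
      exacts [h.1, h.2 j hj]
    · funext ω
      congr 2
      ext ω'
      simp [funext_iff]
  simp only [finiteDTC, hfull, hi, Finset.sum_add_distrib, Finset.sum_const, Finset.card_univ,
    Fintype.card_fin, nsmul_eq_mul]
  ring

end DTC

/-! ### Quantizations have smaller dual total correlation -/

/-- Every finite quantization map can be modified on a null set so that its nonempty cells have
positive measure. -/
theorem exists_goodQuantizer {X β : Type*} [MeasurableSpace X] [Fintype β] [MeasurableSpace β]
    [MeasurableSingletonClass β] (m : Measure X) [IsProbabilityMeasure m] {r : X → β}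
    (hr : Measurable r) : ∃ r', GoodQuantizer m r' ∧ r' =ᵐ[m] r := by
  classical
  have hex : ∃ b₀, m (r ⁻¹' {b₀}) ≠ 0 := by
    by_contra! h
    have hU : (⋃ b, r ⁻¹' {b}) = Set.univ := by ext y; simp
    have : m Set.univ = 0 := by rw [← hU]; exact measure_iUnion_null h
    simp at this
  obtain ⟨b₀, hb₀⟩ := hex
  let e : β → β := fun b => if m (r ⁻¹' {b}) = 0 then b₀ else b
  have he : ∀ b, m (r ⁻¹' {e b}) ≠ 0 := by
    intro b
    by_cases h : m (r ⁻¹' {b}) = 0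
    · simp [e, h, hb₀]
    · simp [e, h]
  have hee : ∀ b, e (e b) = e b := fun b => by
    have := he b
    change (if m (r ⁻¹' {e b}) = 0 then b₀ else e b) = e b
    rw [if_neg this]
  refine ⟨fun y => e (r y), ⟨(measurable_of_finite e).comp hr, fun y h => ?_⟩, ?_⟩
  · refine he (r y) (measure_mono_null (fun z hz => ?_) h)
    simp only [Set.mem_preimage, Set.mem_singleton_iff] at hz ⊢
    rw [hz, hee]
  · have : ∀ᵐ y ∂m, m (r ⁻¹' {r y}) ≠ 0 := by
      have hnull : m (⋃ b ∈ {b | m (r ⁻¹' {b}) = 0}, r ⁻¹' {b}) = 0 :=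
        (measure_biUnion_null_iff (Set.to_countable _)).2 fun b hb => hb
      refine measure_mono_null (fun y hy => ?_) hnull
      simp only [Set.mem_compl_iff, Set.mem_ofPred_eq, not_not] at hy
      simpa using hy
    filter_upwards [this] with y hy
    simp [e, hy]

section Quantize

variable {ι : Type*} [Fintype ι] [DecidableEq ι] {K : ι → Type*} [∀ i, MeasurableSpace (K i)]
  {lam : ∀ i, Measure (K i)} [∀ i, IsProbabilityMeasure (lam i)]
  {α : ι → Type*} [∀ i, MeasurableSpace (α i)] [∀ i, Fintype (α i)]
  [∀ i, MeasurableSingletonClass (α i)] {q : ∀ i, K i → α i}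

omit [Fintype ι] [DecidableEq ι] [∀ i, MeasurableSpace (K i)] [∀ i, MeasurableSpace (α i)]
  [∀ i, Fintype (α i)] [∀ i, MeasurableSingletonClass (α i)] in
theorem setOf_cell_eq_pi (S : Finset ι) (x : ∀ j, K j) :
    {y : ∀ j, K j | ∀ j ∈ S, q j (y j) = q j (x j)}
      = Set.pi S fun j => q j ⁻¹' {q j (x j)} := by
  ext y
  simp [Set.mem_pi]

omit [∀ i, Fintype (α i)] in
/-- A function which is constant on the cells of the quantization of the coordinates in `S`, and
has the same integrals over these cells as a density of `μ`, is the ratio of the masses given to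
the cells by `μ` and by the product measure. -/
theorem measureReal_cell {μ : Measure (∀ j, K j)} {p h : (∀ j, K j) → ℝ}
    (hμ : ∀ φ, BoundedMeasurable φ → ∫ x, φ x ∂μ = ∫ x, p x * φ x ∂Measure.pi lam)
    (hq : ∀ i, GoodQuantizer (lam i) (q i)) (S : Finset ι)
    (hS : ∀ i ∈ S, CellInvariant i (q i) h) (hSc : ∀ i ∉ S, CellInvariant i (fun _ => ()) h)
    (hint : ∀ φ, BoundedMeasurable φ → (∀ i, CellInvariant i (q i) φ) →
      (∀ i ∉ S, CellInvariant i (fun _ => ()) φ) →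
      ∫ x, h x * φ x ∂Measure.pi lam = ∫ x, p x * φ x ∂Measure.pi lam) (x : ∀ j, K j) :
    μ.real {y | ∀ j ∈ S, q j (y j) = q j (x j)}
      = h x * ∏ j ∈ S, (lam j).real (q j ⁻¹' {q j (x j)}) := by
  classical
  set c : Set (∀ j, K j) := {y | ∀ j ∈ S, q j (y j) = q j (x j)} with hc
  have hcm : MeasurableSet c := by
    rw [hc, setOf_cell_eq_pi]
    exact MeasurableSet.pi S.countable_toSet fun j _ =>
      (hq j).measurable (measurableSet_singleton _)
  set φ : (∀ j, K j) → ℝ := c.indicator 1 with hφ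
  have bφ : BoundedMeasurable φ := by
    refine BoundedMeasurable.of_bounds (a := 0) (b := 1) (measurable_one.indicator hcm)
      (fun y => Set.indicator_nonneg (fun _ _ => zero_le_one) y) fun y => ?_
    exact Set.indicator_le' (fun _ _ => le_rfl) (fun _ _ => zero_le_one) y
  have hmem : ∀ i y z, (i ∈ S → q i z = q i (y i)) → (Function.update y i z ∈ c ↔ y ∈ c) := by
    intro i y z hz
    simp only [hc, Set.mem_ofPred_eq]
    refine forall₂_congr fun j hj => ?_
    rcases eq_or_ne j i with rfl | hji
    · rw [Function.update_self, hz hj]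
    · rw [Function.update_of_ne hji]
  have hφ1 : ∀ i, CellInvariant i (q i) φ := fun i y z hz => by
    simp only [hφ, Set.indicator_apply, Pi.one_apply, hmem i y z fun _ => hz]
  have hφ2 : ∀ i ∉ S, CellInvariant i (fun _ => ()) φ := fun i hi y z _ => by
    simp only [hφ, Set.indicator_apply, Pi.one_apply, hmem i y z fun h => absurd h hi]
  have hconst : ∀ y, h y * φ y = h x * φ y := by
    intro y
    by_cases hy : y ∈ c
    · congr 1
      refine CellInvariant.eq_of_forall
        (q := fun j z => if j ∈ S then q j z else q j (x j)) (fun i => ?_) fun i => ?_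
      · by_cases hi : i ∈ S
        · simpa [hi] using hS i hi
        · exact (hSc i hi).of_coord
      · by_cases hi : i ∈ S
        · simpa [hi] using hy i hi
        · simp [hi]
    · simp [hφ, hy]
  have h1 : ∫ y, φ y ∂μ = μ.real c := by rw [hφ, integral_indicator_one hcm]
  have h2 : ∫ y, φ y ∂Measure.pi lam = ∏ j ∈ S, (lam j).real (q j ⁻¹' {q j (x j)}) := by
    rw [hφ, integral_indicator_one hcm, hc, setOf_cell_eq_pi, measureReal_def,
      Measure.pi_pi_finset, ENNReal.toReal_prod]
    rfl
  rw [← h1, hμ φ bφ, ← hint φ bφ hφ1 hφ2, ← h2, ← integral_const_mul]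
  exact integral_congr_ae (Filter.Eventually.of_forall hconst)

end Quantize

section

variable {n : ℕ} {K : Fin n → Type*} [∀ i, MeasurableSpace (K i)]
  {lam : ∀ i, Measure (K i)} [∀ i, IsProbabilityMeasure (lam i)]
  {α : Fin n → Type*} [∀ i, MeasurableSpace (α i)] [∀ i, Fintype (α i)]
  [∀ i, MeasurableSingletonClass (α i)] {q : ∀ i, K i → α i}
  {μ : Measure (∀ j, K j)} [IsProbabilityMeasure μ] {p : (∀ j, K j) → ℝ} {c : ℝ}

theorem finiteDTC_le_of_goodQuantizer
    (hμ : ∀ φ, BoundedMeasurable φ → ∫ x, φ x ∂μ = ∫ x, p x * φ x ∂Measure.pi lam)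
    (hp : BoundedMeasurable p) (hc : 0 < c) (hcp : ∀ x, c ≤ p x)
    (hq : ∀ i, GoodQuantizer (lam i) (q i)) :
    finiteDTC μ (fun i x => q i (x i)) ≤ dtcFunctional lam p := by
  obtain ⟨g, hg, hcg, hinv, hint, hle⟩ := exists_quantized_density hq hp hc hcp Finset.univ
  refine le_trans (le_of_eq ?_) hle
  have hinv' : ∀ i, CellInvariant i (q i) g := fun i => hinv i (Finset.mem_univ i)
  have he := fun i => goodQuantizer_const (lam i)
  have bE : ∀ i, BoundedMeasurable (coordAverage lam i g) := fun i =>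
    boundedMeasurable_cellAverage lam (he i) hg
  have cE : ∀ i x, c ≤ coordAverage lam i g x := fun i => le_cellAverage lam (he i) hg hcg
  have iE : ∀ i j, CellInvariant j (q j) (coordAverage lam i g) := by
    intro i j
    rcases eq_or_ne j i with rfl | hji
    · exact (cellInvariant_cellAverage lam g).of_coord
    · exact (hinv' j).cellAverage_of_ne lam hji
  -- the entropy integrals are expectations of logarithms under `μ`
  have hent : entropyInt lam g = ∫ x, Real.log (g x) ∂μ := by
    rw [hμ _ (hg.log hc hcg), ← hint _ (hg.log hc hcg) fun i => (hinv' i).comp _]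
    rfl
  have hentE : ∀ i, entropyInt lam (coordAverage lam i g)
      = ∫ x, Real.log (coordAverage lam i g x) ∂μ := by
    intro i
    rw [entropyInt_cellAverage (he i) hg hc hcg, hμ _ ((bE i).log hc (cE i)),
      ← hint _ ((bE i).log hc (cE i)) fun j => (iE i j).comp _]
  -- both densities are ratios of masses of cells
  have hcell := measureReal_cell hμ hq Finset.univ hinv (by simp) fun φ hφ hφq _ => hint φ hφ hφq
  have hcellE := fun i => measureReal_cell hμ hq (Finset.univ.erase i)
    (h := coordAverage lam i g) (fun j _ => iE i j)
    (fun j hj => by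
      obtain rfl : j = i := by simpa using hj
      exact cellInvariant_cellAverage lam g)
    fun φ hφ hφq hφi => by
      rw [integral_cellAverage_mul lam (he i) hg hφ (hφi i (by simp)), hint φ hφ hφq]
  have hpos : ∀ j (x : ∀ j, K j), (lam j).real (q j ⁻¹' {q j (x j)}) ≠ 0 := fun j x =>
    ENNReal.toReal_ne_zero.2 ⟨(hq j).ne_zero (x j), measure_ne_top _ _⟩
  have hpos' : ∀ (S : Finset (Fin n)) (x : ∀ j, K j),
      ∏ j ∈ S, (lam j).real (q j ⁻¹' {q j (x j)}) ≠ 0 := fun S x =>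
    Finset.prod_ne_zero_iff.2 fun j _ => hpos j x
  have bl : ∀ j, BoundedMeasurable fun x : ∀ j, K j =>
      Real.log ((lam j).real (q j ⁻¹' {q j (x j)})) := fun j =>
    ⟨(measurable_of_finite fun b => Real.log ((lam j).real (q j ⁻¹' {b}))).comp
      ((hq j).measurable.comp (measurable_pi_apply j)),
      ∑ b, |Real.log ((lam j).real (q j ⁻¹' {b}))|, fun x =>
      Finset.single_le_sum (f := fun b => |Real.log ((lam j).real (q j ⁻¹' {b}))|)
        (fun _ _ => abs_nonneg _) (Finset.mem_univ (q j (x j)))⟩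
  have hlog : ∫ x, Real.log (μ.real {y | ∀ j ∈ Finset.univ, q j (y j) = q j (x j)}) ∂μ
      = ∫ x, Real.log (g x) ∂μ
        + ∑ j, ∫ x, Real.log ((lam j).real (q j ⁻¹' {q j (x j)})) ∂μ := by
    rw [← integral_finsetSum _ fun j _ => (bl j).integrable μ,
      ← integral_add ((hg.log hc hcg).integrable μ)
        ((BoundedMeasurable.sum _ fun j _ => bl j).integrable μ)]
    refine integral_congr_ae (Filter.Eventually.of_forall fun x => ?_)
    simp only [hcell]
    rw [Real.log_mul (hc.trans_le (hcg x)).ne' (hpos' _ x),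
      Real.log_prod fun j _ => hpos j x]
  have hlogE : ∀ i, ∫ x, Real.log (μ.real {y | ∀ j ∈ Finset.univ.erase i,
        q j (y j) = q j (x j)}) ∂μ = ∫ x, Real.log (coordAverage lam i g x) ∂μ
        + ∑ j ∈ Finset.univ.erase i,
          ∫ x, Real.log ((lam j).real (q j ⁻¹' {q j (x j)})) ∂μ := by
    intro i
    rw [← integral_finsetSum _ fun j _ => (bl j).integrable μ,
      ← integral_add (((bE i).log hc (cE i)).integrable μ)
        ((BoundedMeasurable.sum _ fun j _ => bl j).integrable μ)]
    refine integral_congr_ae (Filter.Eventually.of_forall fun x => ?_)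
    simp only [hcellE]
    rw [Real.log_mul (hc.trans_le (cE i x)).ne' (hpos' _ x),
      Real.log_prod fun j _ => hpos j x]
  have hqm : ∀ i, Measurable fun x : ∀ j, K j => q i (x i) := fun i =>
    (hq i).measurable.comp (measurable_pi_apply i)
  rw [finiteDTC_eq_integral hqm, hlog]
  simp only [hlogE, dtcFunctional, hent, hentE, Fintype.card_fin, Finset.sum_add_distrib,
    Finset.sum_erase_eq_sub (Finset.mem_univ _), Finset.sum_sub_distrib, Finset.sum_const,
    Finset.card_univ, nsmul_eq_mul]
  ring

/-- Data processing for the dual total correlation: the dual total correlation of any finite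
quantization is at most that of the density. -/
theorem finiteDTC_le
    (hμ : ∀ φ, BoundedMeasurable φ → ∫ x, φ x ∂μ = ∫ x, p x * φ x ∂Measure.pi lam)
    (hac : μ ≪ Measure.pi lam) (hp : BoundedMeasurable p) (hc : 0 < c) (hcp : ∀ x, c ≤ p x)
    (hq : ∀ i, Measurable (q i)) :
    finiteDTC μ (fun i x => q i (x i)) ≤ dtcFunctional lam p := by
  choose q' hq' hqq' using fun i => exists_goodQuantizer (lam i) (hq i)
  have hqm : ∀ i, Measurable fun x : ∀ j, K j => q i (x i) := fun i =>
    (hq i).comp (measurable_pi_apply i)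
  have hqm' : ∀ i, Measurable fun x : ∀ j, K j => q' i (x i) := fun i =>
    (hq' i).measurable.comp (measurable_pi_apply i)
  rw [finiteDTC_congr hqm hqm' fun i => ?_]
  · exact finiteDTC_le_of_goodQuantizer hμ hp hc hcp hq'
  · exact hac.ae_le ((Measure.quasiMeasurePreserving_eval lam i).ae_eq_comp (hqq' i).symm)

theorem dtcFunctional_nonneg
    (hμ : ∀ φ, BoundedMeasurable φ → ∫ x, φ x ∂μ = ∫ x, p x * φ x ∂Measure.pi lam)
    (hp : BoundedMeasurable p) (hc : 0 < c) (hcp : ∀ x, c ≤ p x) : 0 ≤ dtcFunctional lam p := by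
  have h := finiteDTC_le_of_goodQuantizer hμ hp hc hcp fun i => goodQuantizer_const (lam i)
  rw [finiteDTC_eq_integral fun i => measurable_const] at h
  simpa using h

end

end GibbsMixture

/-! ### A linearized Pinsker inequality -/

namespace GibbsMixture

/-- The scalar inequality behind Pinsker's inequality. Twice differentiating the difference of the
two sides gives `4 * (log s + s⁻¹ - 1) ≥ 0`, and value and derivative vanish at `s = 1`. -/
theorem three_mul_sq_le_mul_klFun {s : ℝ} (hs : 0 ≤ s) :
    3 * (s - 1) ^ 2 ≤ (2 * s + 4) * klFun s := by
  set F : ℝ → ℝ := fun s => (2 * s + 4) * klFun s - 3 * (s - 1) ^ 2 with hF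
  set G : ℝ → ℝ := fun s => (4 * s + 4) * Real.log s - 8 * s + 8 with hG
  have hFd : ∀ s, 0 < s → HasDerivAt F (G s) s := by
    intro s hs
    have h1 : HasDerivAt (fun s : ℝ => 2 * s + 4) 2 s := by
      simpa using ((hasDerivAt_id s).const_mul 2).add_const 4
    have h2 : HasDerivAt (fun s : ℝ => 3 * (s - 1) ^ 2) (3 * (2 * (s - 1))) s := by
      simpa using (((hasDerivAt_id s).sub_const 1).pow 2).const_mul 3
    refine ((h1.mul (hasDerivAt_klFun hs.ne')).sub h2).congr_deriv ?_
    simp only [klFun_apply, hG]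
    ring
  have hGd : ∀ s, 0 < s → HasDerivAt G (4 * (Real.log s + s⁻¹ - 1)) s := by
    intro s hs
    have h1 : HasDerivAt (fun s : ℝ => 4 * s + 4) 4 s := by
      simpa using ((hasDerivAt_id s).const_mul 4).add_const 4
    have h2 : HasDerivAt (fun s : ℝ => 8 * s) 8 s := by
      simpa using (hasDerivAt_id s).const_mul 8
    refine (((h1.mul (Real.hasDerivAt_log hs.ne')).sub h2).add_const 8).congr_deriv ?_
    field_simp
    ring
  have hGmono : MonotoneOn G (Set.Ioi 0) := by
    refine monotoneOn_of_deriv_nonneg (convex_Ioi 0)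
      (fun s hs => (hGd s hs).continuousAt.continuousWithinAt)
      (fun s hs => (hGd s (by simpa using hs)).differentiableAt.differentiableWithinAt)
      fun s hs => ?_
    have hs' : 0 < s := by simpa using hs
    rw [(hGd s hs').deriv]
    have := Real.one_sub_inv_le_log_of_pos hs'
    linarith
  have hG1 : G 1 = 0 := by simp [hG]
  have hF1 : F 1 = 0 := by simp [hF, klFun_one]
  have hFc : Continuous F := by
    have := continuous_klFun
    fun_prop
  suffices h : 0 ≤ F s by
    simp only [hF] at h
    linarith
  rcases le_total s 1 with h1 | h1
  · have hanti : AntitoneOn F (Set.Icc 0 1) := by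
      refine antitoneOn_of_deriv_nonpos (convex_Icc 0 1) hFc.continuousOn
        (fun s hs => ?_) fun s hs => ?_ <;> rw [interior_Icc] at hs
      · exact (hFd s hs.1).differentiableAt.differentiableWithinAt
      · rw [(hFd s hs.1).deriv, ← hG1]
        exact hGmono hs.1 (Set.mem_Ioi.2 one_pos) hs.2.le
    rw [← hF1]
    exact hanti ⟨hs, h1⟩ ⟨zero_le_one, le_rfl⟩ h1
  · have hmono : MonotoneOn F (Set.Ici 1) := by
      refine monotoneOn_of_deriv_nonneg (convex_Ici 1) hFc.continuousOn
        (fun s hs => ?_) fun s hs => ?_ <;> rw [interior_Ici] at hs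
      · exact (hFd s (one_pos.trans hs)).differentiableAt.differentiableWithinAt
      · rw [(hFd s (one_pos.trans hs)).deriv, ← hG1]
        exact hGmono (Set.mem_Ioi.2 one_pos) (Set.mem_Ioi.2 (one_pos.trans hs)) (le_of_lt hs)
    rw [← hF1]
    exact hmono (Set.mem_Ici.2 le_rfl) h1 h1

theorem abs_sub_le_of_pos {t b c : ℝ} (ht : 0 ≤ t) (hb : 0 < b) (hc : 0 < c) :
    |t - b| ≤ (t * Real.log t - t * Real.log b - t + b) / (2 * c) + c * (t + 2 * b) / 3 := by
  set D := t * Real.log t - t * Real.log b - t + b with hD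
  have hkl : b * klFun (t / b) = D := by
    rcases ht.eq_or_lt with rfl | ht'
    · simp [hD, klFun_apply]
    · rw [klFun_apply, Real.log_div ht'.ne' hb.ne', hD]
      field_simp
      ring
  have hD0 : 0 ≤ D := by
    rw [← hkl]
    exact mul_nonneg hb.le (klFun_nonneg (div_nonneg ht hb.le))
  have hmain : 3 * (t - b) ^ 2 ≤ (2 * t + 4 * b) * D := by
    have h := mul_le_mul_of_nonneg_left (three_mul_sq_le_mul_klFun (div_nonneg ht hb.le))
      (sq_nonneg b)
    have h1 : b ^ 2 * (3 * (t / b - 1) ^ 2) = 3 * (t - b) ^ 2 := by field_simp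
    have h2 : b ^ 2 * ((2 * (t / b) + 4) * klFun (t / b))
        = (2 * t + 4 * b) * (b * klFun (t / b)) := by field_simp
    rwa [h1, h2, hkl] at h
  refine abs_le_of_sq_le_sq ?_ (by positivity)
  have h4 : 4 * (D / (2 * c)) * (c * (t + 2 * b) / 3) = (2 * t + 4 * b) * D / 3 := by
    field_simp
    ring
  nlinarith [sq_nonneg (D / (2 * c) - c * (t + 2 * b) / 3)]

/-- Pinsker's inequality for a density with respect to a probability measure, with the square root
replaced by its tangents. -/
theorem integral_abs_sub_integral_le {X : Type*} [MeasurableSpace X] (m : Measure X)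
    [IsProbabilityMeasure m] {a : X → ℝ} (ha : BoundedMeasurable a) (h0 : ∀ x, 0 ≤ a x)
    {c : ℝ} (hc : 0 < c) :
    ∫ x, |a x - ∫ y, a y ∂m| ∂m
      ≤ (∫ x, a x * Real.log (a x) ∂m - (∫ y, a y ∂m) * Real.log (∫ y, a y ∂m)) / (2 * c)
        + c * ∫ y, a y ∂m := by
  set b := ∫ y, a y ∂m with hb
  rcases (integral_nonneg h0 : 0 ≤ b).eq_or_lt with hb0 | hb0
  · have hz : a =ᵐ[m] 0 := (integral_eq_zero_iff_of_nonneg h0 (ha.integrable m)).1 hb0.symm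
    have hbz : b = 0 := hb0.symm
    have h1 : ∫ x, |a x - b| ∂m = 0 := by
      refine integral_eq_zero_of_ae ?_
      filter_upwards [hz] with x hx
      simp [hx, hbz]
    have h2 : ∫ x, a x * Real.log (a x) ∂m = 0 := by
      refine integral_eq_zero_of_ae ?_
      filter_upwards [hz] with x hx
      simp [hx]
    rw [h1, h2, hbz]
    simp
  · have bφ : BoundedMeasurable fun x => a x * Real.log (a x) :=
      ha.comp_continuous Real.continuous_mul_log
    have i1 := bφ.integrable m
    have i2 := ha.integrable m
    have hb' : ∫ y, a y ∂m = b := rfl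
    have habs := ((ha.sub (.const b)).comp_continuous continuous_abs).integrable m
    have j1 : Integrable (fun x => a x * Real.log (a x) - a x * Real.log b) m :=
      i1.sub (i2.mul_const _)
    have j2 : Integrable (fun x => a x * Real.log (a x) - a x * Real.log b - a x) m := j1.sub i2
    have j3 : Integrable (fun x => a x * Real.log (a x) - a x * Real.log b - a x + b) m :=
      j2.add (integrable_const b)
    have j4 : Integrable (fun x => c * (a x + 2 * b) / 3) m :=
      ((i2.add (integrable_const (2 * b))).const_mul c).div_const 3
    refine (integral_mono habs ((j3.div_const (2 * c)).add j4)
      fun x => abs_sub_le_of_pos (h0 x) hb0 hc).trans_eq ?_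
    simp only [Pi.add_apply]
    rw [integral_add (j3.div_const (2 * c)) j4, integral_div, integral_add j2 (integrable_const b),
      integral_sub j1 i2, integral_sub i1 (i2.mul_const _), integral_mul_const, integral_div,
      integral_const_mul, integral_add i2 (integrable_const _), hb']
    simp only [integral_const, probReal_univ, one_smul]
    ring

section

variable {ι : Type*} [Fintype ι] [DecidableEq ι] {K : ι → Type*} [∀ i, MeasurableSpace (K i)]
  {lam : ∀ i, Measure (K i)} [∀ i, IsProbabilityMeasure (lam i)] {ρ : (∀ j, K j) → ℝ}

theorem integral_abs_sub_coordAverage_le (hρ : BoundedMeasurable ρ) (h0 : ∀ x, 0 ≤ ρ x) (i : ι)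
    {c : ℝ} (hc : 0 < c) :
    ∫ x, |ρ x - coordAverage lam i ρ x| ∂Measure.pi lam
      ≤ (entropyInt lam ρ - entropyInt lam (coordAverage lam i ρ)) / (2 * c)
        + c * ∫ x, ρ x ∂Measure.pi lam := by
  have he := goodQuantizer_const (lam i)
  have bE : BoundedMeasurable (coordAverage lam i ρ) := boundedMeasurable_cellAverage lam he hρ
  have hE : ∀ x y, coordAverage lam i ρ (Function.update x i y) = coordAverage lam i ρ x :=
    fun x y => cellInvariant_cellAverage lam ρ x y rfl
  have bφ : BoundedMeasurable fun x => ρ x * Real.log (ρ x) :=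
    hρ.comp_continuous Real.continuous_mul_log
  have bφE : BoundedMeasurable fun x => coordAverage lam i ρ x * Real.log (coordAverage lam i ρ x) :=
    bE.comp_continuous Real.continuous_mul_log
  have babs := (hρ.sub bE).comp_continuous continuous_abs
  have bφi : BoundedMeasurable (coordAverage lam i fun x => ρ x * Real.log (ρ x)) :=
    boundedMeasurable_cellAverage lam he bφ
  have babsi : BoundedMeasurable (coordAverage lam i fun x => |ρ x - coordAverage lam i ρ x|) :=
    boundedMeasurable_cellAverage lam he babs
  have i1 := bφi.integrable (Measure.pi lam)
  have i2 := bφE.integrable (Measure.pi lam)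
  have i3 := bE.integrable (Measure.pi lam)
  have i4 : Integrable (fun x => (coordAverage lam i (fun x => ρ x * Real.log (ρ x)) x
      - coordAverage lam i ρ x * Real.log (coordAverage lam i ρ x)) / (2 * c))
      (Measure.pi lam) := (i1.sub i2).div_const _
  have i5 : Integrable (fun x => c * coordAverage lam i ρ x) (Measure.pi lam) := i3.const_mul c
  unfold entropyInt
  rw [← integral_cellAverage lam he babs, ← integral_cellAverage lam he bφ,
    ← integral_cellAverage lam he hρ, ← integral_sub i1 i2, ← integral_div, ← integral_const_mul,
    ← integral_add i4 i5]
  refine integral_mono (babsi.integrable _) (i4.add i5) fun x => ?_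
  have h := integral_abs_sub_integral_le (lam i) (boundedMeasurable_update hρ x) (fun _ => h0 _) hc
  change coordAverage lam i (fun x => |ρ x - coordAverage lam i ρ x|) x
    ≤ (coordAverage lam i (fun x => ρ x * Real.log (ρ x)) x
      - coordAverage lam i ρ x * Real.log (coordAverage lam i ρ x)) / (2 * c)
      + c * coordAverage lam i ρ x
  rw [coordAverage_apply, coordAverage_apply lam i fun x => ρ x * Real.log (ρ x)]
  simp only [hE]
  rw [coordAverage_apply lam i ρ]
  exact h

end

end GibbsMixture

/-! ### The transportation distance -/

namespace GibbsMixture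

section Transport

variable {n : ℕ} {K : Fin n → Type*} [∀ i, MetricSpace (K i)] [∀ i, MeasurableSpace (K i)]

omit [∀ i, MeasurableSpace (K i)] in
theorem hammingAverage_nonneg (x y : ∀ i, K i) : 0 ≤ hammingAverage x y :=
  div_nonneg (Finset.sum_nonneg fun _ _ => dist_nonneg) (Nat.cast_nonneg n)

omit [∀ i, MeasurableSpace (K i)] in
theorem hammingAverage_self (x : ∀ i, K i) : hammingAverage x x = 0 := by
  simp [hammingAverage]

omit [∀ i, MeasurableSpace (K i)] in
theorem hammingAverage_triangle (x y z : ∀ i, K i) :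
    hammingAverage x z ≤ hammingAverage x y + hammingAverage y z := by
  unfold hammingAverage
  rw [← add_div, ← Finset.sum_add_distrib]
  exact div_le_div_of_nonneg_right (Finset.sum_le_sum fun i _ => dist_triangle _ _ _)
    (Nat.cast_nonneg n)

omit [∀ i, MeasurableSpace (K i)] in
theorem hammingAverage_update_le {i : Fin n} (hdiam : ∀ a b : K i, dist a b ≤ 1)
    (x : ∀ i, K i) (y : K i) : hammingAverage x (Function.update x i y) ≤ 1 / n := by
  unfold hammingAverage
  refine div_le_div_of_nonneg_right ?_ (Nat.cast_nonneg n)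
  rw [Finset.sum_eq_single i (fun j _ hj => by rw [Function.update_of_ne hj, dist_self])
    (fun h => absurd (Finset.mem_univ i) h), Function.update_self]
  exact hdiam _ _

theorem transportDist_le_of_coupling {μ ν : Measure (∀ i, K i)}
    (γ : Measure ((∀ i, K i) × (∀ i, K i))) (h1 : γ.fst = μ) (h2 : γ.snd = ν) :
    transportDist μ ν ≤ ∫⁻ z, ENNReal.ofReal (hammingAverage z.1 z.2) ∂γ :=
  iInf₂_le γ ⟨h1, h2⟩

variable [∀ i, TopologicalSpace.SeparableSpace (K i)] [∀ i, BorelSpace (K i)]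

theorem measurable_hammingAverage :
    Measurable fun z : (∀ i, K i) × (∀ i, K i) => ENNReal.ofReal (hammingAverage z.1 z.2) := by
  have : ∀ i, SecondCountableTopology (K i) := fun i =>
    UniformSpace.secondCountable_of_separable (K i)
  refine ENNReal.measurable_ofReal.comp (Measurable.div_const ?_ _)
  exact Finset.measurable_fun_sum _ fun i _ =>
    ((measurable_pi_apply i).comp measurable_fst).dist
      ((measurable_pi_apply i).comp measurable_snd)

theorem transportDist_self (μ : Measure (∀ i, K i)) : transportDist μ μ = 0 := by
  have hm : Measurable fun x : ∀ i, K i => (x, x) := measurable_id.prodMk measurable_id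
  refine le_antisymm ((transportDist_le_of_coupling (μ.map fun x => (x, x)) ?_ ?_).trans ?_) zero_le
  · rw [Measure.fst, Measure.map_map measurable_fst hm]
    exact Measure.map_id
  · rw [Measure.snd, Measure.map_map measurable_snd hm]
    exact Measure.map_id
  · rw [lintegral_map measurable_hammingAverage hm]
    simp [hammingAverage_self]

/-- The triangle inequality for the transportation distance. Two couplings with a common marginal
are glued along it by disintegrating the second one. -/
theorem transportDist_triangle [∀ i, CompleteSpace (K i)] [∀ i, Nonempty (K i)]
    (μ₁ μ₂ μ₃ : Measure (∀ i, K i)) [IsFiniteMeasure μ₁] [IsFiniteMeasure μ₂] :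
    transportDist μ₁ μ₃ ≤ transportDist μ₁ μ₂ + transportDist μ₂ μ₃ := by
  have : ∀ i, SecondCountableTopology (K i) := fun i =>
    UniformSpace.secondCountable_of_separable (K i)
  conv_rhs => unfold transportDist
  simp only [ENNReal.iInf_add, ENNReal.add_iInf]
  refine le_iInf₂ fun γ' hγ' => le_iInf₂ fun γ hγ => ?_
  have : IsFiniteMeasure γ := ⟨by
    rw [← Measure.fst_univ, hγ.1]; exact measure_lt_top _ _⟩
  have : IsFiniteMeasure γ' := ⟨by
    rw [← Measure.fst_univ, hγ'.1]; exact measure_lt_top _ _⟩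
  set κ := γ'.condKernel with hκ
  -- the joint law of `((x, y), z)` with `(x, y)` distributed as `γ` and `(y, z)` as `γ'`
  set Γ : Measure (((∀ i, K i) × (∀ i, K i)) × (∀ i, K i)) :=
    γ.compProd (Kernel.prodMkLeft (∀ i, K i) κ) with hΓ
  have hfst : Γ.fst = γ := Measure.fst_compProd γ _
  have hyz : Measurable fun w : ((∀ i, K i) × (∀ i, K i)) × (∀ i, K i) => (w.1.2, w.2) :=
    (measurable_snd.comp measurable_fst).prodMk measurable_snd
  have hxz : Measurable fun w : ((∀ i, K i) × (∀ i, K i)) × (∀ i, K i) => (w.1.1, w.2) :=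
    (measurable_fst.comp measurable_fst).prodMk measurable_snd
  have hmap : Γ.map (fun w => (w.1.2, w.2)) = γ' := by
    refine Measure.ext_of_lintegral _ fun F hF => ?_
    have hF' : Measurable fun w : ((∀ i, K i) × (∀ i, K i)) × (∀ i, K i) => F (w.1.2, w.2) :=
      hF.comp hyz
    rw [lintegral_map hF hyz, hΓ, Measure.lintegral_compProd hF']
    have h1 : Measurable fun y => ∫⁻ z, F (y, z) ∂κ y := hF.lintegral_kernel_prod_right'
    have h2 : ∫⁻ w, (∫⁻ z, F (w.2, z) ∂κ w.2) ∂γ = ∫⁻ y, (∫⁻ z, F (y, z) ∂κ y) ∂γ.snd := by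
      rw [Measure.snd, lintegral_map h1 measurable_snd]
    simp only [Kernel.prodMkLeft_apply]
    rw [h2, hγ.2, ← hγ'.1, ← Measure.lintegral_compProd hF, hκ, Measure.disintegrate]
  refine (transportDist_le_of_coupling (Γ.map fun w => (w.1.1, w.2)) ?_ ?_).trans ?_
  · rw [Measure.fst, Measure.map_map measurable_fst hxz, ← hγ.1, ← hfst, Measure.fst, Measure.fst,
      Measure.map_map measurable_fst measurable_fst]
    rfl
  · rw [Measure.snd, Measure.map_map measurable_snd hxz, ← hγ'.2, ← hmap, Measure.snd,
      Measure.map_map measurable_snd hyz]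
    rfl
  · have hd := measurable_hammingAverage (K := K)
    have e1 : ∫⁻ z, ENNReal.ofReal (hammingAverage z.1 z.2) ∂γ
        = ∫⁻ w, ENNReal.ofReal (hammingAverage w.1.1 w.1.2) ∂Γ := by
      rw [← hfst, Measure.fst, lintegral_map hd measurable_fst]
    have e2 : ∫⁻ z, ENNReal.ofReal (hammingAverage z.1 z.2) ∂γ'
        = ∫⁻ w, ENNReal.ofReal (hammingAverage w.1.2 w.2) ∂Γ := by
      rw [← hmap, lintegral_map hd hyz]
    have hd' : Measurable fun w : ((∀ i, K i) × (∀ i, K i)) × (∀ i, K i) =>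
        ENNReal.ofReal (hammingAverage w.1.1 w.1.2) := hd.comp measurable_fst
    rw [e1, e2, lintegral_map hd hxz, ← lintegral_add_left hd']
    refine lintegral_mono fun w => ?_
    rw [← ENNReal.ofReal_add (hammingAverage_nonneg _ _)
      (hammingAverage_nonneg _ _)]
    exact ENNReal.ofReal_le_ofReal (hammingAverage_triangle _ _ _)

end Transport

section Coupling

variable {ι : Type*} [Fintype ι] [DecidableEq ι] {K : ι → Type*} [∀ i, MeasurableSpace (K i)]
  (lam : ∀ i, Measure (K i)) [∀ i, IsProbabilityMeasure (lam i)] (k : ι)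

/-- The average of an `ℝ≥0∞`-valued function over the `k`-th coordinate. -/
noncomputable def coordLAverage (U : (∀ j, K j) → ℝ≥0∞) (x : ∀ j, K j) : ℝ≥0∞ :=
  ∫⁻ y, U (Function.update x k y) ∂lam k

variable {lam k} {U V m : (∀ j, K j) → ℝ≥0∞}

omit [Fintype ι] in
theorem measurable_coordLAverage (hU : Measurable U) : Measurable (coordLAverage lam k U) := by
  have h : Measurable fun z : (∀ j, K j) × K k => U (Function.update z.1 k z.2) :=
    hU.comp measurable_update'
  exact h.lintegral_prod_right'

omit [Fintype ι] [∀ i, IsProbabilityMeasure (lam i)] in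
theorem coordLAverage_update (x : ∀ j, K j) (y : K k) :
    coordLAverage lam k U (Function.update x k y) = coordLAverage lam k U x := by
  simp [coordLAverage]

/-- Dividing and multiplying by the average of `U` is harmless: where that average vanishes, so does
`U`, up to a null set. -/
theorem lintegral_mul_inv_coordLAverage (hU : Measurable U)
    (hfin : ∀ x, coordLAverage lam k U x ≠ ∞) {F : (∀ j, K j) → ℝ≥0∞} :
    ∫⁻ x, U x * (coordLAverage lam k U x)⁻¹ * coordLAverage lam k U x * F x ∂Measure.pi lam
      = ∫⁻ x, U x * F x ∂Measure.pi lam := by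
  have hSm := measurable_coordLAverage (lam := lam) (k := k) hU
  have hN : MeasurableSet {x | coordLAverage lam k U x = 0} := hSm (measurableSet_singleton 0)
  have hind : Measurable ({x | coordLAverage lam k U x = 0}.indicator U) := hU.indicator hN
  have hz : ∫⁻ x, {x | coordLAverage lam k U x = 0}.indicator U x ∂Measure.pi lam = 0 := by
    rw [← lintegral_update lam k hind]
    refine (lintegral_congr fun x => ?_).trans lintegral_zero
    by_cases hx : coordLAverage lam k U x = 0
    · simp only [Set.indicator_apply, Set.mem_ofPred_eq, coordLAverage_update, hx, if_true]
      exact hx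
    · simp [coordLAverage_update, hx]
  have hae := (lintegral_eq_zero_iff hind).1 hz
  refine lintegral_congr_ae ?_
  filter_upwards [hae] with x hx
  by_cases h0 : coordLAverage lam k U x = 0
  · have hU0 : U x = 0 := by simpa [Set.indicator_apply, h0] using hx
    simp [hU0]
  · rw [mul_assoc (U x), ENNReal.inv_mul_cancel h0 (hfin x), mul_one]

variable (lam k) in
/-- Optimal coupling along one coordinate of the measures with densities `m + U` and `m + V`, where
`U` and `V` have equal averages over the `k`-th coordinate: the common part `m` stays in place,
and the `k`-th coordinate of the part `U` is resampled from `V`. -/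
noncomputable def resampleCoupling (m U V : (∀ j, K j) → ℝ≥0∞) :
    Measure ((∀ j, K j) × (∀ j, K j)) :=
  ((Measure.pi lam).withDensity m).map (fun x => (x, x)) +
    (((Measure.pi lam).prod (lam k)).withDensity fun z =>
      U z.1 * (coordLAverage lam k U z.1)⁻¹ * V (Function.update z.1 k z.2)).map
      fun z => (z.1, Function.update z.1 k z.2)

theorem lintegral_resampleCoupling (hm : Measurable m) (hU : Measurable U) (hV : Measurable V)
    {F : (∀ j, K j) × (∀ j, K j) → ℝ≥0∞} (hF : Measurable F) :
    ∫⁻ z, F z ∂resampleCoupling lam k m U V = ∫⁻ x, m x * F (x, x) ∂Measure.pi lam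
      + ∫⁻ x, ∫⁻ y, U x * (coordLAverage lam k U x)⁻¹ * V (Function.update x k y)
          * F (x, Function.update x k y) ∂lam k ∂Measure.pi lam := by
  have h1 : Measurable fun x : ∀ j, K j => (x, x) := measurable_id.prodMk measurable_id
  have hup : Measurable fun z : (∀ j, K j) × K k => Function.update z.1 k z.2 := measurable_update'
  have h2 : Measurable fun z : (∀ j, K j) × K k => (z.1, Function.update z.1 k z.2) :=
    measurable_fst.prodMk hup
  have hSm := measurable_coordLAverage (lam := lam) (k := k) hU
  have hD : Measurable fun z : (∀ j, K j) × K k =>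
      U z.1 * (coordLAverage lam k U z.1)⁻¹ * V (Function.update z.1 k z.2) :=
    ((hU.comp measurable_fst).mul (hSm.comp measurable_fst).inv).mul (hV.comp hup)
  have hF1 : Measurable fun x => F (x, x) := hF.comp h1
  have hF2 : Measurable fun z : (∀ j, K j) × K k => F (z.1, Function.update z.1 k z.2) :=
    hF.comp h2
  rw [resampleCoupling, lintegral_add_measure, lintegral_map hF h1, lintegral_map hF h2,
    lintegral_withDensity_eq_lintegral_mul _ hm hF1,
    lintegral_withDensity_eq_lintegral_mul _ hD hF2, lintegral_prod _ (hD.mul hF2).aemeasurable]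
  rfl

theorem fst_resampleCoupling (hm : Measurable m) (hU : Measurable U) (hV : Measurable V)
    (hfin : ∀ x, coordLAverage lam k U x ≠ ∞)
    (hUV : ∀ x, coordLAverage lam k U x = coordLAverage lam k V x) :
    (resampleCoupling lam k m U V).fst = (Measure.pi lam).withDensity (m + U) := by
  refine Measure.ext_of_lintegral _ fun F hF => ?_
  have hF' : Measurable fun z : (∀ j, K j) × (∀ j, K j) => F z.1 := hF.comp measurable_fst
  rw [Measure.fst, lintegral_map hF measurable_fst, lintegral_resampleCoupling hm hU hV hF',
    lintegral_withDensity_eq_lintegral_mul _ (hm.add hU) hF]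
  simp only [Pi.mul_apply, Pi.add_apply, add_mul]
  rw [lintegral_add_left (show Measurable fun x => m x * F x from hm.mul hF), ← lintegral_mul_inv_coordLAverage hU hfin]
  congr 1
  refine lintegral_congr fun x => ?_
  have hVx : Measurable fun y => V (Function.update x k y) := hV.comp (measurable_update x)
  rw [lintegral_mul_const _ (hVx.const_mul _), lintegral_const_mul _ hVx, hUV]
  rfl

theorem snd_resampleCoupling (hm : Measurable m) (hU : Measurable U) (hV : Measurable V)
    (hfin : ∀ x, coordLAverage lam k U x ≠ ∞)
    (hUV : ∀ x, coordLAverage lam k U x = coordLAverage lam k V x) :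
    (resampleCoupling lam k m U V).snd = (Measure.pi lam).withDensity (m + V) := by
  have hSm := measurable_coordLAverage (lam := lam) (k := k) hV
  have hup : Measurable fun z : (∀ j, K j) × K k => Function.update z.1 k z.2 := measurable_update'
  refine Measure.ext_of_lintegral _ fun F hF => ?_
  have hF' : Measurable fun z : (∀ j, K j) × (∀ j, K j) => F z.2 := hF.comp measurable_snd
  rw [Measure.snd, lintegral_map hF measurable_snd, lintegral_resampleCoupling hm hU hV hF',
    lintegral_withDensity_eq_lintegral_mul _ (hm.add hV) hF]
  simp only [Pi.mul_apply, Pi.add_apply, add_mul]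
  rw [lintegral_add_left (show Measurable fun x => m x * F x from hm.mul hF),
    ← lintegral_mul_inv_coordLAverage hV (fun x => by rw [← hUV]; exact hfin x)]
  congr 1
  have hH : Measurable (Function.uncurry fun (x : ∀ j, K j) (y : K k) =>
      U (Function.update x k y) * ((coordLAverage lam k V x)⁻¹ * V x * F x)) :=
    (hU.comp hup).mul (((hSm.inv.mul hV).mul hF).comp measurable_fst)
  refine Eq.trans ?_ ((lintegral_update_swap lam k hH).trans ?_)
  · refine lintegral_congr fun x => lintegral_congr fun y => ?_
    simp only [Function.update_idem, Function.update_eq_self, coordLAverage_update, hUV]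
    ring
  · refine lintegral_congr fun x => ?_
    have hUx : Measurable fun y => U (Function.update x k y) := hU.comp (measurable_update x)
    rw [lintegral_mul_const _ hUx]
    change coordLAverage lam k U x * _ = _
    rw [hUV]
    ring

end Coupling

end GibbsMixture

/-! ### Marton's transportation inequality -/

namespace GibbsMixture

section Marton

variable {n : ℕ} {K : Fin n → Type*} [∀ i, MetricSpace (K i)] [∀ i, MeasurableSpace (K i)]
  [∀ i, TopologicalSpace.SeparableSpace (K i)] [∀ i, BorelSpace (K i)]
  {lam : ∀ i, Measure (K i)} [∀ i, IsProbabilityMeasure (lam i)] {ρ : (∀ j, K j) → ℝ}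

/-- The measure with density `ρ` relative to the product measure. -/
noncomputable def densityMeasure {ι : Type*} [Fintype ι] {K : ι → Type*}
    [∀ i, MeasurableSpace (K i)] (lam : ∀ i, Measure (K i)) (ρ : (∀ j, K j) → ℝ) :
    Measure (∀ j, K j) :=
  (Measure.pi lam).withDensity fun x => ENNReal.ofReal (ρ x)

theorem lintegral_ofReal_eq_of_integral_eq_zero {X : Type*} [MeasurableSpace X] {m : Measure X}
    [IsFiniteMeasure m] {g : X → ℝ} (hg : BoundedMeasurable g) (h0 : ∫ x, g x ∂m = 0) :
    ∫⁻ x, ENNReal.ofReal (g x) ∂m = ∫⁻ x, ENNReal.ofReal (-g x) ∂m := by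
  have hi := hg.integrable m
  rw [integral_eq_lintegral_pos_part_sub_lintegral_neg_part hi, sub_eq_zero] at h0
  exact (ENNReal.toReal_eq_toReal_iff' hi.lintegral_lt_top.ne hi.neg.lintegral_lt_top.ne).1 h0

/-- Replacing the `k`-th coordinate by an independent sample from the reference measure moves a
measure by at most `1 / n` times the total variation. -/
theorem transportDist_coordAverage_le (hρ : BoundedMeasurable ρ) (h0 : ∀ x, 0 ≤ ρ x) {k : Fin n}
    (hdiam : ∀ a b : K k, dist a b ≤ 1) :
    transportDist (densityMeasure lam ρ) (densityMeasure lam (coordAverage lam k ρ))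
      ≤ ENNReal.ofReal ((∫ x, |ρ x - coordAverage lam k ρ x| ∂Measure.pi lam) / (2 * n)) := by
  have he := goodQuantizer_const (lam k)
  set E := coordAverage lam k ρ with hE
  have bE : BoundedMeasurable E := boundedMeasurable_cellAverage lam he hρ
  have hE0 : ∀ x, 0 ≤ E x := le_cellAverage lam he hρ h0
  have hEup : ∀ x y, E (Function.update x k y) = E x :=
    fun x y => cellInvariant_cellAverage lam ρ x y rfl
  have bg : BoundedMeasurable fun x => ρ x - E x := hρ.sub bE
  set m : (∀ j, K j) → ℝ≥0∞ := fun x => ENNReal.ofReal (min (ρ x) (E x)) with hm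
  set U : (∀ j, K j) → ℝ≥0∞ := fun x => ENNReal.ofReal (ρ x - E x) with hU
  set V : (∀ j, K j) → ℝ≥0∞ := fun x => ENNReal.ofReal (E x - ρ x) with hV
  have mm : Measurable m := ENNReal.measurable_ofReal.comp (hρ.1.min bE.1)
  have mU : Measurable U := ENNReal.measurable_ofReal.comp (hρ.1.sub bE.1)
  have mV : Measurable V := ENNReal.measurable_ofReal.comp (bE.1.sub hρ.1)
  have bgx : ∀ x, BoundedMeasurable fun y => ρ (Function.update x k y) - E x := fun x =>
    (boundedMeasurable_update hρ x).sub (.const _)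
  have hfin : ∀ x, coordLAverage lam k U x ≠ ∞ := by
    intro x
    simp only [coordLAverage, hU, hEup]
    exact ((bgx x).integrable _).lintegral_lt_top.ne
  have hUV : ∀ x, coordLAverage lam k U x = coordLAverage lam k V x := by
    intro x
    simp only [coordLAverage, hU, hV, hEup]
    rw [lintegral_ofReal_eq_of_integral_eq_zero (bgx x)]
    · simp only [neg_sub]
    · rw [integral_sub ((boundedMeasurable_update hρ x).integrable _) (integrable_const _), hE,
        coordAverage_apply]
      simp
  have hmU : m + U = fun x => ENNReal.ofReal (ρ x) := by
    funext x
    simp only [Pi.add_apply, hm, hU]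
    rcases le_total (ρ x) (E x) with h | h
    · rw [min_eq_left h, ENNReal.ofReal_of_nonpos (sub_nonpos.2 h), add_zero]
    · rw [min_eq_right h, ← ENNReal.ofReal_add (hE0 x) (sub_nonneg.2 h)]
      congr 1
      ring
  have hmV : m + V = fun x => ENNReal.ofReal (E x) := by
    funext x
    simp only [Pi.add_apply, hm, hV]
    rcases le_total (ρ x) (E x) with h | h
    · rw [min_eq_left h, ← ENNReal.ofReal_add (h0 x) (sub_nonneg.2 h)]
      congr 1
      ring
    · rw [min_eq_right h, ENNReal.ofReal_of_nonpos (sub_nonpos.2 h), add_zero]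
  refine (transportDist_le_of_coupling (resampleCoupling lam k m U V)
    ((fst_resampleCoupling mm mU mV hfin hUV).trans (by rw [hmU, densityMeasure]))
    ((snd_resampleCoupling mm mU mV hfin hUV).trans (by rw [hmV, densityMeasure]))).trans ?_
  rw [lintegral_resampleCoupling mm mU mV measurable_hammingAverage]
  simp only [hammingAverage_self, ENNReal.ofReal_zero, mul_zero, lintegral_zero, zero_add]
  have habs := bg.comp_continuous continuous_abs
  have hUint : ∫⁻ x, U x ∂Measure.pi lam
      = ENNReal.ofReal ((∫ x, |ρ x - E x| ∂Measure.pi lam) / 2) := by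
    have hg0 : ∫ x, (ρ x - E x) ∂Measure.pi lam = 0 := by
      rw [integral_sub (hρ.integrable _) (bE.integrable _), hE, integral_cellAverage lam he hρ,
        sub_self]
    have h2 : ∫ x, (|ρ x - E x| + (ρ x - E x)) / 2 ∂Measure.pi lam
        = (∫ x, |ρ x - E x| ∂Measure.pi lam) / 2 := by
      rw [integral_div, integral_add (habs.integrable _) (bg.integrable _), hg0, add_zero]
    have h3 : Integrable (fun x => (|ρ x - E x| + (ρ x - E x)) / 2) (Measure.pi lam) :=
      ((habs.integrable _).add (bg.integrable _)).div_const 2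
    rw [← h2, ofReal_integral_eq_lintegral_ofReal h3
      (Filter.Eventually.of_forall fun x => ?_)]
    · refine lintegral_congr fun x => ?_
      simp only [hU]
      rcases le_total 0 (ρ x - E x) with h | h
      · rw [abs_of_nonneg h, add_self_div_two]
      · rw [abs_of_nonpos h, ENNReal.ofReal_of_nonpos h]
        simp
    · have := neg_abs_le (ρ x - E x)
      simp only [Pi.zero_apply]
      linarith
  calc ∫⁻ x, ∫⁻ y, U x * (coordLAverage lam k U x)⁻¹ * V (Function.update x k y)
          * ENNReal.ofReal (hammingAverage x (Function.update x k y)) ∂lam k ∂Measure.pi lam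
      ≤ ∫⁻ x, ∫⁻ y, U x * (coordLAverage lam k U x)⁻¹ * V (Function.update x k y)
          * ENNReal.ofReal (1 / n) ∂lam k ∂Measure.pi lam := by
        refine lintegral_mono fun x => lintegral_mono fun y => ?_
        gcongr
        exact hammingAverage_update_le hdiam x y
    _ = ∫⁻ x, U x * (coordLAverage lam k U x)⁻¹ * coordLAverage lam k U x
          * ENNReal.ofReal (1 / n) ∂Measure.pi lam := by
        refine lintegral_congr fun x => ?_
        have hVx : Measurable fun y => V (Function.update x k y) := mV.comp (measurable_update x)
        rw [lintegral_mul_const _ (hVx.const_mul _), lintegral_const_mul _ hVx]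
        conv_rhs => rw [mul_assoc (U x), hUV x, ← mul_assoc]
        rw [hUV x]
        rfl
    _ = ENNReal.ofReal ((∫ x, |ρ x - E x| ∂Measure.pi lam) / (2 * n)) := by
        rw [lintegral_mul_inv_coordLAverage mU hfin, lintegral_mul_const _ mU, hUint,
          ← ENNReal.ofReal_mul (div_nonneg (integral_nonneg fun _ => abs_nonneg _) zero_le_two)]
        congr 1
        ring

omit [∀ i, MetricSpace (K i)] [∀ i, TopologicalSpace.SeparableSpace (K i)]
  [∀ i, BorelSpace (K i)] in
theorem isProbabilityMeasure_densityMeasure (hρ : BoundedMeasurable ρ) (h0 : ∀ x, 0 ≤ ρ x)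
    (h1 : ∫ x, ρ x ∂Measure.pi lam = 1) : IsProbabilityMeasure (densityMeasure lam ρ) := by
  refine ⟨?_⟩
  rw [densityMeasure, withDensity_apply _ MeasurableSet.univ, Measure.restrict_univ,
    ← ofReal_integral_eq_lintegral_ofReal (hρ.integrable _) (Filter.Eventually.of_forall h0), h1,
    ENNReal.ofReal_one]

/-- Marton's transportation inequality for product measures, with the square root replaced by its
tangents: `√(D / (2 * n)) ≤ D / (4 * c * n) + c / 2`. The coordinates are resampled from the
reference measure one after another; the losses of entropy add up to the relative entropy. -/
theorem transportDist_densityMeasure_le [∀ i, CompleteSpace (K i)] [∀ i, Nonempty (K i)]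
    (hdiam : ∀ i, ∀ a b : K i, dist a b ≤ 1) (hn : 0 < n) (hρ : BoundedMeasurable ρ)
    (h0 : ∀ x, 0 ≤ ρ x) (h1 : ∫ x, ρ x ∂Measure.pi lam = 1) {c : ℝ} (hc : 0 < c) :
    transportDist (densityMeasure lam ρ) (Measure.pi lam)
      ≤ ENNReal.ofReal (entropyInt lam ρ / (4 * c * n) + c / 2) := by
  have hn' : (0 : ℝ) < n := Nat.cast_pos.2 hn
  have key : ∀ S : Finset (Fin n), ∃ σ, BoundedMeasurable σ ∧ (∀ x, 0 ≤ σ x) ∧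
      ∫ x, σ x ∂Measure.pi lam = 1 ∧ (∀ i ∈ S, CellInvariant i (fun _ => ()) σ) ∧
      0 ≤ (entropyInt lam ρ - entropyInt lam σ) / (4 * c * n) + S.card * (c / (2 * n)) ∧
      transportDist (densityMeasure lam ρ) (densityMeasure lam σ)
        ≤ ENNReal.ofReal ((entropyInt lam ρ - entropyInt lam σ) / (4 * c * n)
          + S.card * (c / (2 * n))) := by
    intro S
    induction S using Finset.induction_on with
    | empty => exact ⟨ρ, hρ, h0, h1, by simp, by simp, by simp [transportDist_self]⟩
    | insert k S hk ih =>
      obtain ⟨σ, bσ, hσ0, hσ1, hinv, hnn, hle⟩ := ih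
      have he := goodQuantizer_const (lam k)
      have := isProbabilityMeasure_densityMeasure hρ h0 h1
      have := isProbabilityMeasure_densityMeasure bσ hσ0 hσ1
      have hstep := transportDist_coordAverage_le (lam := lam) bσ hσ0 (hdiam k)
      have hpin := integral_abs_sub_coordAverage_le (lam := lam) bσ hσ0 k hc
      set τ := coordAverage lam k σ with hτ
      have hpin' : (∫ x, |σ x - τ x| ∂Measure.pi lam) / (2 * n)
          ≤ (entropyInt lam σ - entropyInt lam τ) / (4 * c * n) + c / (2 * n) := by
        rw [div_le_iff₀ (by positivity)]
        refine hpin.trans_eq ?_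
        rw [hσ1]
        field_simp
        ring
      have hpos : 0 ≤ (entropyInt lam σ - entropyInt lam τ) / (4 * c * n) + c / (2 * n) :=
        le_trans (div_nonneg (integral_nonneg fun _ => abs_nonneg _) (by positivity)) hpin'
      have hsum : (entropyInt lam ρ - entropyInt lam τ) / (4 * c * n)
          + (insert k S).card * (c / (2 * n))
          = ((entropyInt lam ρ - entropyInt lam σ) / (4 * c * n) + S.card * (c / (2 * n)))
            + ((entropyInt lam σ - entropyInt lam τ) / (4 * c * n) + c / (2 * n)) := by
        rw [Finset.card_insert_of_notMem hk]
        push_cast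
        ring
      refine ⟨τ, boundedMeasurable_cellAverage lam he bσ, le_cellAverage lam he bσ hσ0,
        (integral_cellAverage lam he bσ).trans hσ1, fun i hi => ?_, ?_, ?_⟩
      · rcases eq_or_ne i k with rfl | hik
        · exact cellInvariant_cellAverage lam σ
        · exact (hinv i (Finset.mem_of_mem_insert_of_ne hi hik)).cellAverage_of_ne lam hik
      · rw [hsum]
        exact add_nonneg hnn hpos
      · rw [hsum, ENNReal.ofReal_add hnn hpos]
        exact (transportDist_triangle _ (densityMeasure lam σ) _).trans
          (add_le_add hle (hstep.trans (ENNReal.ofReal_le_ofReal hpin')))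
  obtain ⟨σ, -, -, hσ1, hinv, -, hle⟩ := key Finset.univ
  -- a density which depends on no coordinate is identically one
  have hσ : ∀ x, σ x = 1 := by
    intro x
    have hconst : ∀ y, σ y = σ x := fun y =>
      CellInvariant.eq_of_forall (q := fun _ _ => ()) (fun i => hinv i (Finset.mem_univ i))
        fun _ => rfl
    simpa [hconst] using hσ1
  have hlam : densityMeasure lam σ = Measure.pi lam := by
    simp [densityMeasure, hσ]
  rw [hlam] at hle
  refine hle.trans_eq ?_
  congr 1
  simp only [entropyInt, hσ, Finset.card_univ, Fintype.card_fin]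
  simp only [Real.log_one, mul_zero, integral_zero, sub_zero]
  field_simp

end Marton

end GibbsMixture

/-! ### Relative entropy of measures with bounded densities -/

namespace GibbsMixture

section Density

variable {ι : Type*} [Fintype ι] {K : ι → Type*} [∀ i, MeasurableSpace (K i)]
  {lam : ∀ i, Measure (K i)} [∀ i, IsProbabilityMeasure (lam i)] {ρ : (∀ j, K j) → ℝ}

omit [∀ i, IsProbabilityMeasure (lam i)] in
theorem integral_densityMeasure (hρ : Measurable ρ) (h0 : ∀ x, 0 ≤ ρ x) (φ : (∀ j, K j) → ℝ) :
    ∫ x, φ x ∂densityMeasure lam ρ = ∫ x, ρ x * φ x ∂Measure.pi lam := by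
  have hm : Measurable fun x => ENNReal.ofReal (ρ x) := ENNReal.measurable_ofReal.comp hρ
  rw [densityMeasure, integral_withDensity_eq_integral_toReal_smul hm
    (Filter.Eventually.of_forall fun _ => ENNReal.ofReal_lt_top)]
  refine integral_congr_ae (Filter.Eventually.of_forall fun x => ?_)
  simp [ENNReal.toReal_ofReal (h0 x)]

theorem entropyInt_eq_integral_klFun (hρ : BoundedMeasurable ρ)
    (h1 : ∫ x, ρ x ∂Measure.pi lam = 1) :
    entropyInt lam ρ = ∫ x, klFun (ρ x) ∂Measure.pi lam := by
  have b1 : BoundedMeasurable fun x => ρ x * Real.log (ρ x) :=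
    hρ.comp_continuous Real.continuous_mul_log
  have i1 : Integrable (fun x => ρ x * Real.log (ρ x) + 1) (Measure.pi lam) :=
    (b1.integrable _).add (integrable_const 1)
  simp only [klFun_apply]
  rw [integral_sub i1 (hρ.integrable _), integral_add (b1.integrable _) (integrable_const 1), h1]
  simp [entropyInt]

theorem entropyInt_nonneg (hρ : BoundedMeasurable ρ) (h0 : ∀ x, 0 ≤ ρ x)
    (h1 : ∫ x, ρ x ∂Measure.pi lam = 1) : 0 ≤ entropyInt lam ρ := by
  rw [entropyInt_eq_integral_klFun hρ h1]
  exact integral_nonneg fun x => klFun_nonneg (h0 x)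

theorem klDiv_densityMeasure (hρ : BoundedMeasurable ρ) (h0 : ∀ x, 0 ≤ ρ x)
    (h1 : ∫ x, ρ x ∂Measure.pi lam = 1) :
    klDiv (densityMeasure lam ρ) (Measure.pi lam) = ENNReal.ofReal (entropyInt lam ρ) := by
  have hm : Measurable fun x => ENNReal.ofReal (ρ x) := ENNReal.measurable_ofReal.comp hρ.1
  have hfin : IsFiniteMeasure (densityMeasure lam ρ) := isFiniteMeasure_withDensity
    (hρ.integrable (Measure.pi lam)).lintegral_lt_top.ne
  have hac : densityMeasure lam ρ ≪ Measure.pi lam := withDensity_absolutelyContinuous _ _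
  rw [klDiv_eq_lintegral_klFun_of_ac hac,
    entropyInt_eq_integral_klFun hρ h1, ofReal_integral_eq_lintegral_ofReal
      ((hρ.comp_continuous continuous_klFun).integrable _)
      (Filter.Eventually.of_forall fun x => klFun_nonneg (h0 x))]
  refine lintegral_congr_ae ?_
  filter_upwards [Measure.rnDeriv_withDensity (Measure.pi lam) hm] with x hx
  rw [densityMeasure, hx, ENNReal.toReal_ofReal (h0 x)]

end Density

/-! ### Gibbs measures -/

namespace BoundedMeasurable

variable {Ω : Type*} [MeasurableSpace Ω] {g : Ω → ℝ}

theorem exp (hg : BoundedMeasurable g) : BoundedMeasurable fun x => Real.exp (g x) :=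
  hg.comp_continuous Real.continuous_exp

theorem exists_le_exp (hg : BoundedMeasurable g) : ∃ c, 0 < c ∧ ∀ x, c ≤ Real.exp (g x) := by
  obtain ⟨-, C, hC⟩ := hg
  exact ⟨Real.exp (-C), Real.exp_pos _, fun x => Real.exp_le_exp.2 (abs_le.1 (hC x)).1⟩

theorem integral_exp_pos (hg : BoundedMeasurable g) (m : Measure Ω) [IsProbabilityMeasure m] :
    0 < ∫ x, Real.exp (g x) ∂m :=
  MeasureTheory.integral_exp_pos (hg.exp.integrable m)

end BoundedMeasurable

section Gibbs

variable {n : ℕ} {K : Fin n → Type*} [∀ i, MeasurableSpace (K i)]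
  (lam : ∀ i, Measure (K i)) [∀ i, IsProbabilityMeasure (lam i)]

/-- The Gibbs measure of a sum of functions of single coordinates is a product measure. -/
theorem gibbs_sum (g : ∀ i, K i → ℝ) (hg : ∀ i, BoundedMeasurable (g i)) :
    gibbs lam (fun x => ∑ i, g i (x i)) = Measure.pi fun i => (lam i).tilted (g i) := by
  have hprob : ∀ i, IsProbabilityMeasure ((lam i).tilted (g i)) := fun i =>
    isProbabilityMeasure_tilted ((hg i).exp.integrable _)
  refine (Measure.pi_eq fun s hs => ?_).symm
  have hZ : ∫ x, Real.exp (∑ i, g i (x i)) ∂Measure.pi lam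
      = ∏ i, ∫ y, Real.exp (g i y) ∂lam i := by
    simp only [Real.exp_sum]
    exact integral_fintype_prod_eq_prod fun i y => Real.exp (g i y)
  have hnn : ∀ i y, 0 ≤ Real.exp (g i y) / ∫ z, Real.exp (g i z) ∂lam i := fun i y =>
    div_nonneg (Real.exp_pos _).le (integral_nonneg fun _ => (Real.exp_pos _).le)
  rw [gibbs, tilted_apply_eq_ofReal_integral' _ (MeasurableSet.univ_pi hs), hZ,
    Measure.restrict_pi_pi]
  simp only [Real.exp_sum, ← Finset.prod_div_distrib]
  rw [integral_fintype_prod_eq_prod fun i y => Real.exp (g i y) / ∫ z, Real.exp (g i z) ∂lam i,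
    ENNReal.ofReal_prod_of_nonneg fun i _ => integral_nonneg (hnn i)]
  exact Finset.prod_congr rfl fun i _ => (tilted_apply_eq_ofReal_integral' _ (hs i)).symm

variable (star : ∀ i, K i) (f : (∀ i, K i) → ℝ)

/-- The logarithm of the partition function of the potential `∇f (x, ·)`. -/
noncomputable def logPartition (x : ∀ i, K i) : ℝ :=
  ∑ i, Real.log (∫ y, Real.exp (discretePartial star f i x y) ∂lam i)

variable {star f}

theorem boundedMeasurable_discretePartial (hf : BoundedMeasurable f) (i : Fin n) :
    BoundedMeasurable fun z : (∀ j, K j) × K i => discretePartial star f i z.1 z.2 :=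
  (hf.comp_measurable measurable_update').sub
    (hf.comp_measurable (measurable_update'.comp (measurable_fst.prodMk measurable_const)))

theorem boundedMeasurable_discretePartial_right (hf : BoundedMeasurable f) (i : Fin n)
    (x : ∀ j, K j) : BoundedMeasurable (discretePartial star f i x) :=
  (boundedMeasurable_discretePartial hf i).comp_measurable (measurable_const.prodMk measurable_id)

theorem boundedMeasurable_discreteGradient (hf : BoundedMeasurable f) :
    BoundedMeasurable fun z : (∀ j, K j) × (∀ j, K j) => discreteGradient star f z.1 z.2 :=
  BoundedMeasurable.sum _ fun i _ => (boundedMeasurable_discretePartial hf i).comp_measurable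
    (measurable_fst.prodMk ((measurable_pi_apply i).comp measurable_snd))

theorem boundedMeasurable_logPartition (hf : BoundedMeasurable f) :
    BoundedMeasurable (logPartition lam star f) := by
  refine BoundedMeasurable.sum _ fun i _ => ?_
  have hb := (boundedMeasurable_discretePartial (star := star) hf i)
  obtain ⟨c, hc, hle⟩ := hb.exists_le_exp
  refine (hb.exp.integral_prod_right (lam i)).log hc fun x => ?_
  simpa using integral_mono (μ := lam i) (integrable_const c)
    ((boundedMeasurable_discretePartial_right hf i x).exp.integrable _) fun y => hle (x, y)

theorem integral_exp_discreteGradient (hf : BoundedMeasurable f) (x : ∀ j, K j) :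
    ∫ z, Real.exp (discreteGradient star f x z) ∂Measure.pi lam
      = Real.exp (logPartition lam star f x) := by
  simp only [discreteGradient, logPartition, Real.exp_sum]
  rw [integral_fintype_prod_eq_prod fun i y => Real.exp (discretePartial star f i x y)]
  exact Finset.prod_congr rfl fun i _ => (Real.exp_log
    ((boundedMeasurable_discretePartial_right hf i x).integral_exp_pos _)).symm

variable (star f) in
/-- The integrand whose expectation under the Gibbs measure of `f` is minus its dual total
correlation. -/
noncomputable def dtcDefect (x : ∀ i, K i) : ℝ :=
  f x - Real.log (∫ z, Real.exp (f z) ∂Measure.pi lam) + logPartition lam star f x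
    - discreteGradient star f x x

theorem boundedMeasurable_discreteGradient_diag (hf : BoundedMeasurable f) :
    BoundedMeasurable fun x => discreteGradient star f x x :=
  (boundedMeasurable_discreteGradient hf).comp_measurable (measurable_id.prodMk measurable_id)

theorem boundedMeasurable_dtcDefect (hf : BoundedMeasurable f) :
    BoundedMeasurable (dtcDefect lam star f) :=
  ((hf.sub (.const _)).add (boundedMeasurable_logPartition lam hf)).sub
    (boundedMeasurable_discreteGradient_diag hf)

omit [∀ i, IsProbabilityMeasure (lam i)] in
theorem gibbs_eq_densityMeasure (g : (∀ i, K i) → ℝ) :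
    gibbs lam g = densityMeasure lam fun x => Real.exp (g x) / ∫ z, Real.exp (g z) ∂Measure.pi lam :=
  rfl

omit [∀ i, IsProbabilityMeasure (lam i)] in
theorem boundedMeasurable_gibbsDensity (hf : BoundedMeasurable f) :
    BoundedMeasurable fun x => Real.exp (f x) / ∫ z, Real.exp (f z) ∂Measure.pi lam := by
  simpa only [div_eq_mul_inv] using hf.exp.mul (.const _)

theorem exists_le_gibbsDensity (hf : BoundedMeasurable f) :
    ∃ c, 0 < c ∧ ∀ x, c ≤ Real.exp (f x) / ∫ z, Real.exp (f z) ∂Measure.pi lam := by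
  obtain ⟨c, hc, hle⟩ := hf.exists_le_exp
  have hZ := hf.integral_exp_pos (Measure.pi lam)
  exact ⟨c / ∫ z, Real.exp (f z) ∂Measure.pi lam, div_pos hc hZ, fun x =>
    div_le_div_of_nonneg_right (hle x) hZ.le⟩

omit [∀ i, IsProbabilityMeasure (lam i)] in
theorem integral_gibbs (hf : BoundedMeasurable f) (φ : (∀ i, K i) → ℝ) :
    ∫ x, φ x ∂gibbs lam f
      = ∫ x, Real.exp (f x) / (∫ z, Real.exp (f z) ∂Measure.pi lam) * φ x ∂Measure.pi lam := by
  rw [gibbs_eq_densityMeasure, integral_densityMeasure (boundedMeasurable_gibbsDensity lam hf).1]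
  exact fun x => div_nonneg (Real.exp_pos _).le (integral_nonneg fun _ => (Real.exp_pos _).le)

theorem isProbabilityMeasure_gibbs (hf : BoundedMeasurable f) :
    IsProbabilityMeasure (gibbs lam f) :=
  isProbabilityMeasure_tilted (hf.exp.integrable _)

/-- The dual total correlation of a Gibbs measure. The conditional law of the `i`-th coordinate
given the others is the `i`-th factor of the Gibbs measure of `∇f (x, ·)`. -/
theorem dtcFunctional_gibbs (star : ∀ i, K i) (hf : BoundedMeasurable f) :
    dtcFunctional lam (fun x => Real.exp (f x) / ∫ z, Real.exp (f z) ∂Measure.pi lam)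
      = -∫ x, dtcDefect lam star f x ∂gibbs lam f := by
  set Z := ∫ z, Real.exp (f z) ∂Measure.pi lam with hZ
  have hZpos : 0 < Z := hf.integral_exp_pos (Measure.pi lam)
  set p : (∀ i, K i) → ℝ := fun x => Real.exp (f x) / Z with hp
  have bp : BoundedMeasurable p := boundedMeasurable_gibbsDensity lam hf
  obtain ⟨c, hc, hcp⟩ := exists_le_gibbsDensity lam hf
  have := isProbabilityMeasure_gibbs lam hf
  have he := fun i => goodQuantizer_const (lam i)
  have bE : ∀ i, BoundedMeasurable (coordAverage lam i p) := fun i =>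
    boundedMeasurable_cellAverage lam (he i) bp
  have blogE : ∀ i, BoundedMeasurable fun x => Real.log (coordAverage lam i p x) := fun i =>
    (bE i).log hc (le_cellAverage lam (he i) bp hcp)
  have h1 : entropyInt lam p = ∫ x, Real.log (p x) ∂gibbs lam f := by
    rw [integral_gibbs lam hf]
    rfl
  have h2 : ∀ i, entropyInt lam (coordAverage lam i p)
      = ∫ x, Real.log (coordAverage lam i p x) ∂gibbs lam f := fun i => by
    rw [integral_gibbs lam hf, entropyInt_cellAverage (he i) bp hc hcp]
  have hlogp : ∀ x, Real.log (p x) = f x - Real.log Z := fun x => by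
    rw [hp, Real.log_div (Real.exp_pos _).ne' hZpos.ne', Real.log_exp]
  have hlogE : ∀ i x, Real.log (coordAverage lam i p x) = f (Function.update x i (star i))
      + Real.log (∫ y, Real.exp (discretePartial star f i x y) ∂lam i) - Real.log Z := by
    intro i x
    have hpos := (boundedMeasurable_discretePartial_right (star := star) hf i x).integral_exp_pos
      (lam i)
    have : coordAverage lam i p x = Real.exp (f (Function.update x i (star i)))
        * (∫ y, Real.exp (discretePartial star f i x y) ∂lam i) / Z := by
      rw [coordAverage_apply, ← integral_const_mul, ← integral_div]
      refine integral_congr_ae (Filter.Eventually.of_forall fun y => ?_)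
      simp only [hp, discretePartial, ← Real.exp_add]
      congr 2
      ring
    rw [this, Real.log_div (mul_ne_zero (Real.exp_pos _).ne' hpos.ne') hZpos.ne',
      Real.log_mul (Real.exp_pos _).ne' hpos.ne', Real.log_exp]
  have i1 := (bp.log hc hcp).integrable (gibbs lam f)
  have i2 := fun i => (blogE i).integrable (gibbs lam f)
  rw [dtcFunctional, h1, Finset.sum_congr rfl fun i _ => h2 i, ← integral_finsetSum _ fun i _ => i2 i,
    ← integral_const_mul, ← integral_sub (i1.const_mul _) (integrable_finsetSum _ fun i _ => i2 i),
    ← integral_neg]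
  refine integral_congr_ae (Filter.Eventually.of_forall fun x => ?_)
  simp only [hlogp, hlogE, dtcDefect, logPartition, discreteGradient, discretePartial,
    Function.update_eq_self, Finset.sum_add_distrib, Finset.sum_sub_distrib, Finset.sum_const,
    Finset.card_univ, Fintype.card_fin, nsmul_eq_mul, ← hZ]
  ring

/-! ### The divergence of a conditioned Gibbs measure -/

variable (star f) in
/-- The density of the Gibbs measure of `f`, conditioned on `P`, relative to the Gibbs measure of
`∇f (y, ·)`. -/
noncomputable def condDensity (P : Set (∀ i, K i)) (y : ∀ i, K i) : (∀ i, K i) → ℝ :=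
  P.indicator fun x => Real.exp (f x - discreteGradient star f y x + logPartition lam star f y
    - Real.log (∫ z, Real.exp (f z) ∂Measure.pi lam) - Real.log ((gibbs lam f).real P))

theorem boundedMeasurable_discreteGradient_right (hf : BoundedMeasurable f) (y : ∀ j, K j) :
    BoundedMeasurable (discreteGradient star f y) :=
  (boundedMeasurable_discreteGradient hf).comp_measurable (measurable_const.prodMk measurable_id)

omit [∀ i, IsProbabilityMeasure (lam i)] in
theorem boundedMeasurable_condDensity (hf : BoundedMeasurable f) {P : Set (∀ i, K i)}
    (hP : MeasurableSet P) (y : ∀ i, K i) :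
    BoundedMeasurable (condDensity lam star f P y) := by
  have h : BoundedMeasurable fun x => Real.exp (f x - discreteGradient star f y x
      + logPartition lam star f y - Real.log (∫ z, Real.exp (f z) ∂Measure.pi lam)
      - Real.log ((gibbs lam f).real P)) :=
    ((((hf.sub (boundedMeasurable_discreteGradient_right hf y)).add (.const _)).sub
      (.const _)).sub (.const _)).exp
  obtain ⟨hm, C, hC⟩ := h
  refine ⟨hm.indicator hP, C, fun x => ?_⟩
  by_cases hx : x ∈ P
  · simpa only [condDensity, Set.indicator_of_mem hx] using hC x
  · simpa only [condDensity, Set.indicator_of_notMem hx, abs_zero]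
      using (abs_nonneg _).trans (hC x)

omit [∀ i, IsProbabilityMeasure (lam i)] in
theorem condDensity_nonneg (P : Set (∀ i, K i)) (y x : ∀ i, K i) :
    0 ≤ condDensity lam star f P y x :=
  Set.indicator_nonneg (fun _ _ => (Real.exp_pos _).le) x

theorem gibbs_discreteGradient (hf : BoundedMeasurable f) (y : ∀ j, K j) :
    gibbs lam (discreteGradient star f y)
      = Measure.pi fun i => (lam i).tilted (discretePartial star f i y) :=
  gibbs_sum lam _ fun i => boundedMeasurable_discretePartial_right hf i y

theorem cond_gibbs_eq (hf : BoundedMeasurable f) {P : Set (∀ i, K i)} (hP : MeasurableSet P)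
    (hP0 : gibbs lam f P ≠ 0) (y : ∀ j, K j) :
    (gibbs lam f)[|P] = densityMeasure (fun i => (lam i).tilted (discretePartial star f i y))
      (condDensity lam star f P y) := by
  have := isProbabilityMeasure_gibbs lam hf
  set Z := ∫ z, Real.exp (f z) ∂Measure.pi lam with hZ
  have hZpos : 0 < Z := hf.integral_exp_pos (Measure.pi lam)
  have hPpos : 0 < (gibbs lam f).real P := ENNReal.toReal_pos hP0 (measure_ne_top _ _)
  have hmp : Measurable fun x => ENNReal.ofReal (Real.exp (f x) / Z) :=
    ENNReal.measurable_ofReal.comp (boundedMeasurable_gibbsDensity lam hf).1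
  have hmg : Measurable fun x => ENNReal.ofReal (Real.exp (discreteGradient star f y x)
      / ∫ z, Real.exp (discreteGradient star f y z) ∂Measure.pi lam) :=
    ENNReal.measurable_ofReal.comp (boundedMeasurable_gibbsDensity lam
      (boundedMeasurable_discreteGradient_right hf y)).1
  have hmc : Measurable fun x => ENNReal.ofReal (condDensity lam star f P y x) :=
    ENNReal.measurable_ofReal.comp (boundedMeasurable_condDensity lam hf hP y).1
  have hcond : (gibbs lam f)[|P] = (Measure.pi lam).withDensity
      ((gibbs lam f P)⁻¹ • P.indicator fun x => ENNReal.ofReal (Real.exp (f x) / Z)) := by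
    rw [withDensity_smul _ (hmp.indicator hP), withDensity_indicator hP, ← restrict_withDensity hP]
    rfl
  rw [hcond, densityMeasure, ← gibbs_discreteGradient lam hf y,
    gibbs_eq_densityMeasure lam (discreteGradient star f y), densityMeasure,
    ← withDensity_mul _ hmg hmc]
  congr 1
  funext x
  simp only [Pi.smul_apply, Pi.mul_apply, condDensity, smul_eq_mul]
  by_cases hx : x ∈ P
  · rw [Set.indicator_of_mem hx, Set.indicator_of_mem hx, integral_exp_discreteGradient lam hf,
      ← ENNReal.ofReal_toReal (ENNReal.inv_ne_top.2 hP0), ENNReal.toReal_inv,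
      ← ENNReal.ofReal_mul (by positivity), ← ENNReal.ofReal_mul (by positivity)]
    congr 1
    change ((gibbs lam f).real P)⁻¹ * _ = _
    rw [Real.exp_sub, Real.exp_sub, Real.exp_add, Real.exp_sub, Real.exp_log hZpos,
      Real.exp_log hPpos]
    have h1 := (Real.exp_pos (discreteGradient star f y x)).ne'
    have h2 := (Real.exp_pos (logPartition lam star f y)).ne'
    field_simp
  · simp [hx]

variable (star f) in
/-- The divergence of the Gibbs measure of `f`, conditioned on `P`, from the Gibbs measure of
`∇f (y, ·)`. -/
noncomputable def condDivergence (P : Set (∀ i, K i)) (y : ∀ i, K i) : ℝ :=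
  ∫ x, (f x - discreteGradient star f y x + logPartition lam star f y
    - Real.log (∫ z, Real.exp (f z) ∂Measure.pi lam) - Real.log ((gibbs lam f).real P))
    ∂(gibbs lam f)[|P]

theorem entropyInt_condDensity (hf : BoundedMeasurable f) {P : Set (∀ i, K i)}
    (hP : MeasurableSet P) (hP0 : gibbs lam f P ≠ 0) (y : ∀ j, K j) :
    entropyInt (fun i => (lam i).tilted (discretePartial star f i y))
      (condDensity lam star f P y) = condDivergence lam star f P y := by
  rw [condDivergence, cond_gibbs_eq lam hf hP hP0 y,
    integral_densityMeasure (boundedMeasurable_condDensity lam hf hP y).1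
      (condDensity_nonneg lam P y)]
  refine integral_congr_ae (Filter.Eventually.of_forall fun x => ?_)
  by_cases hx : x ∈ P
  · simp only [condDensity, Set.indicator_of_mem hx, Real.log_exp]
  · simp [condDensity, hx]

theorem integral_condDensity (hf : BoundedMeasurable f) {P : Set (∀ i, K i)}
    (hP : MeasurableSet P) (hP0 : gibbs lam f P ≠ 0) (y : ∀ j, K j) :
    ∫ x, condDensity lam star f P y x
      ∂Measure.pi (fun i => (lam i).tilted (discretePartial star f i y)) = 1 := by
  have := isProbabilityMeasure_gibbs lam hf
  have := cond_isProbabilityMeasure hP0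
  have h := integral_densityMeasure (lam := fun i => (lam i).tilted (discretePartial star f i y))
    (boundedMeasurable_condDensity (star := star) lam hf hP y).1 (condDensity_nonneg lam P y)
    fun _ => 1
  rw [← cond_gibbs_eq lam hf hP hP0 y] at h
  simpa using h.symm

theorem isProbabilityMeasure_tilted_discretePartial (hf : BoundedMeasurable f) (y : ∀ j, K j)
    (i : Fin n) : IsProbabilityMeasure ((lam i).tilted (discretePartial star f i y)) :=
  isProbabilityMeasure_tilted ((boundedMeasurable_discretePartial_right hf i y).exp.integrable _)

theorem klDiv_cond_gibbs (hf : BoundedMeasurable f) {P : Set (∀ i, K i)}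
    (hP : MeasurableSet P) (hP0 : gibbs lam f P ≠ 0) (y : ∀ j, K j) :
    klDiv ((gibbs lam f)[|P]) (gibbs lam (discreteGradient star f y))
      = ENNReal.ofReal (condDivergence lam star f P y) := by
  have := isProbabilityMeasure_tilted_discretePartial lam (star := star) hf y
  rw [cond_gibbs_eq lam hf hP hP0 y, gibbs_discreteGradient lam hf y,
    klDiv_densityMeasure (boundedMeasurable_condDensity lam hf hP y) (condDensity_nonneg lam P y)
      (integral_condDensity lam hf hP hP0 y), entropyInt_condDensity lam hf hP hP0 y]

theorem condDivergence_nonneg (hf : BoundedMeasurable f) {P : Set (∀ i, K i)}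
    (hP : MeasurableSet P) (hP0 : gibbs lam f P ≠ 0) (y : ∀ j, K j) :
    0 ≤ condDivergence lam star f P y := by
  have := isProbabilityMeasure_tilted_discretePartial lam (star := star) hf y
  rw [← entropyInt_condDensity lam hf hP hP0 y]
  exact entropyInt_nonneg (boundedMeasurable_condDensity lam hf hP y) (condDensity_nonneg lam P y)
    (integral_condDensity lam hf hP hP0 y)

variable (star f) in
/-- The average, over two independent samples from the Gibbs measure of `f` conditioned on `P`, of
the variation of the first argument of the discrete gradient. -/
noncomputable def gradientError (P : Set (∀ i, K i)) : ℝ :=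
  ∫ x, ∫ y, (discreteGradient star f x x - discreteGradient star f y x)
    ∂(gibbs lam f)[|P] ∂(gibbs lam f)[|P]

theorem boundedMeasurable_condDivergence (hf : BoundedMeasurable f) {P : Set (∀ i, K i)}
    (hP0 : gibbs lam f P ≠ 0) : BoundedMeasurable (condDivergence lam star f P) := by
  have := isProbabilityMeasure_gibbs lam hf
  have := cond_isProbabilityMeasure hP0
  have h : BoundedMeasurable fun z : (∀ j, K j) × (∀ j, K j) => f z.2
      - discreteGradient star f z.1 z.2 + logPartition lam star f z.1
      - Real.log (∫ z, Real.exp (f z) ∂Measure.pi lam) - Real.log ((gibbs lam f).real P) :=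
    ((((hf.comp_measurable measurable_snd).sub (boundedMeasurable_discreteGradient hf)).add
      ((boundedMeasurable_logPartition lam hf).comp_measurable measurable_fst)).sub
      (.const _)).sub (.const _)
  exact h.integral_prod_right _

theorem integral_condDivergence (hf : BoundedMeasurable f) {P : Set (∀ i, K i)}
    (hP0 : gibbs lam f P ≠ 0) :
    ∫ y, condDivergence lam star f P y ∂(gibbs lam f)[|P]
      = -Real.log ((gibbs lam f).real P) + ∫ x, dtcDefect lam star f x ∂(gibbs lam f)[|P]
        + gradientError lam star f P := by
  have := isProbabilityMeasure_gibbs lam hf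
  have := cond_isProbabilityMeasure hP0
  set ν := (gibbs lam f)[|P] with hν
  set lZ := Real.log (∫ z, Real.exp (f z) ∂Measure.pi lam) with hlZ
  have bL := boundedMeasurable_logPartition lam (star := star) hf
  have bd := boundedMeasurable_discreteGradient_diag (star := star) hf
  have bG := boundedMeasurable_discreteGradient (star := star) hf
  have bGy := fun y => boundedMeasurable_discreteGradient_right (star := star) hf y
  have bGx : ∀ x, BoundedMeasurable fun y => discreteGradient star f y x := fun x =>
    bG.comp_measurable (measurable_id.prodMk measurable_const)
  have bI : BoundedMeasurable fun y => ∫ x, discreteGradient star f y x ∂ν :=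
    bG.integral_prod_right ν
  have bI' : BoundedMeasurable fun x => ∫ y, discreteGradient star f y x ∂ν :=
    (bG.comp_measurable measurable_swap).integral_prod_right ν
  have hD : ∀ y, condDivergence lam star f P y = (∫ x, f x ∂ν)
      - (∫ x, discreteGradient star f y x ∂ν) + logPartition lam star f y - lZ
      - Real.log ((gibbs lam f).real P) := by
    intro y
    have i1 : Integrable (fun x => f x - discreteGradient star f y x) ν :=
      (hf.sub (bGy y)).integrable ν
    have i2 : Integrable (fun x => f x - discreteGradient star f y x
      + logPartition lam star f y) ν := i1.add (integrable_const _)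
    have i3 : Integrable (fun x => f x - discreteGradient star f y x
      + logPartition lam star f y - lZ) ν := i2.sub (integrable_const _)
    rw [condDivergence, integral_sub i3 (integrable_const _),
      integral_sub i2 (integrable_const _), integral_add i1 (integrable_const _),
      integral_sub (hf.integrable ν) ((bGy y).integrable ν)]
    simp only [integral_const, probReal_univ, one_smul]
  have hE : gradientError lam star f P = (∫ x, discreteGradient star f x x ∂ν)
      - ∫ y, ∫ x, discreteGradient star f y x ∂ν ∂ν := by
    have hint : Integrable (Function.uncurry fun y x => discreteGradient star f y x)
        (ν.prod ν) := bG.integrable (ν.prod ν)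
    rw [gradientError, ← hν, integral_integral_swap hint,
      ← integral_sub (bd.integrable ν) (bI'.integrable ν)]
    refine integral_congr_ae (Filter.Eventually.of_forall fun x => ?_)
    simp only
    rw [integral_sub (integrable_const _) ((bGx x).integrable ν)]
    simp
  have hT : ∫ x, dtcDefect lam star f x ∂ν = (∫ x, f x ∂ν) - lZ
      + (∫ x, logPartition lam star f x ∂ν) - ∫ x, discreteGradient star f x x ∂ν := by
    have i1 : Integrable (fun x => f x - lZ) ν := (hf.sub (.const _)).integrable ν
    have i2 : Integrable (fun x => f x - lZ + logPartition lam star f x) ν :=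
      i1.add (bL.integrable ν)
    simp only [dtcDefect, ← hlZ]
    rw [integral_sub i2 (bd.integrable ν), integral_add i1 (bL.integrable ν),
      integral_sub (hf.integrable ν) (integrable_const _)]
    simp
  simp only [hD]
  have j1 : Integrable (fun y => (∫ x, f x ∂ν) - ∫ x, discreteGradient star f y x ∂ν) ν :=
    ((BoundedMeasurable.const _).sub bI).integrable ν
  have j2 : Integrable (fun y => (∫ x, f x ∂ν) - (∫ x, discreteGradient star f y x ∂ν)
      + logPartition lam star f y) ν := j1.add (bL.integrable ν)
  have j3 : Integrable (fun y => (∫ x, f x ∂ν) - (∫ x, discreteGradient star f y x ∂ν)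
      + logPartition lam star f y - lZ) ν := j2.sub (integrable_const _)
  rw [integral_sub j3 (integrable_const _),
    integral_sub j2 (integrable_const _), integral_add j1 (bL.integrable ν),
    integral_sub (integrable_const _) (bI.integrable ν), hE, hT]
  simp only [integral_const, probReal_univ, one_smul]
  ring

end Gibbs

end GibbsMixture

/-! ### Summation over the partition -/

namespace GibbsMixture

theorem integral_lt_of_ae_lt {X : Type*} [MeasurableSpace X] {m : Measure X}
    [IsProbabilityMeasure m] {g : X → ℝ} (hg : Integrable g m) {a : ℝ} (h : ∀ᵐ x ∂m, g x < a) :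
    ∫ x, g x ∂m < a := by
  have hi : Integrable (fun x => a - g x) m := (integrable_const a).sub hg
  have hnn : 0 ≤ᵐ[m] fun x => a - g x := h.mono fun x hx => (sub_pos.2 hx).le
  have he : ∫ x, (a - g x) ∂m = a - ∫ x, g x ∂m := by
    rw [integral_sub (integrable_const a) hg]
    simp
  have hle : 0 ≤ ∫ x, (a - g x) ∂m := integral_nonneg_of_ae hnn
  refine lt_of_le_of_ne (by linarith) fun heq => ?_
  have hz : (fun x => a - g x) =ᵐ[m] 0 :=
    (integral_eq_zero_iff_of_nonneg_ae hnn hi).1 (by rw [he, heq, sub_self])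
  obtain ⟨x, hx, hx0⟩ := (h.and hz).exists
  have : a - g x = 0 := hx0
  linarith

section

variable {n : ℕ} {K : Fin n → Type*} [∀ i, MeasurableSpace (K i)]
  (lam : ∀ i, Measure (K i)) [∀ i, IsProbabilityMeasure (lam i)]
  {star : ∀ i, K i} {f : (∀ i, K i) → ℝ}

theorem abs_gradientError_lt (hf : BoundedMeasurable f) {P : Set (∀ i, K i)}
    (hP : MeasurableSet P) (hP0 : gibbs lam f P ≠ 0) {s : ℝ}
    (hs : ∀ x ∈ P, ∀ y ∈ P,
      |discreteGradient star f x x - discreteGradient star f y x| < s) :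
    |gradientError lam star f P| < s := by
  have := isProbabilityMeasure_gibbs lam hf
  have := cond_isProbabilityMeasure hP0
  have hmem : ∀ᵐ x ∂(gibbs lam f)[|P], x ∈ P := ae_cond_mem hP
  have b : BoundedMeasurable fun z : (∀ j, K j) × (∀ j, K j) =>
      discreteGradient star f z.1 z.1 - discreteGradient star f z.2 z.1 :=
    ((boundedMeasurable_discreteGradient_diag hf).comp_measurable measurable_fst).sub
      ((boundedMeasurable_discreteGradient hf).comp_measurable measurable_swap)
  have bI := b.integral_prod_right ((gibbs lam f)[|P])
  have hx : ∀ x ∈ P, |∫ y, (discreteGradient star f x x - discreteGradient star f y x)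
      ∂(gibbs lam f)[|P]| < s := by
    intro x hx
    have bG : BoundedMeasurable fun y => discreteGradient star f y x :=
      (boundedMeasurable_discreteGradient hf).comp_measurable (measurable_id.prodMk measurable_const)
    have bx := (BoundedMeasurable.const (discreteGradient star f x x)).sub bG
    refine abs_integral_le_integral_abs.trans_lt
      (integral_lt_of_ae_lt ((bx.comp_continuous continuous_abs).integrable _) ?_)
    filter_upwards [hmem] with y hy using hs x hx y hy
  refine abs_integral_le_integral_abs.trans_lt
    (integral_lt_of_ae_lt ((bI.comp_continuous continuous_abs).integrable _) ?_)
  filter_upwards [hmem] with x hxP using hx x hxP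

variable (star f) in
/-- The contribution of the part `P` to the sum of the divergences. -/
noncomputable def partDivergence (P : Set (∀ i, K i)) : ℝ :=
  Real.negMulLog ((gibbs lam f).real P) + ∫ x in P, dtcDefect lam star f x ∂gibbs lam f
    + (gibbs lam f).real P * gradientError lam star f P

theorem lintegral_klDiv_cond (hf : BoundedMeasurable f) {P : Set (∀ i, K i)}
    (hP : MeasurableSet P) :
    gibbs lam f P * ∫⁻ y, klDiv ((gibbs lam f)[|P]) (gibbs lam (discreteGradient star f y))
        ∂(gibbs lam f)[|P] = ENNReal.ofReal (partDivergence lam star f P) ∧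
      0 ≤ partDivergence lam star f P := by
  have := isProbabilityMeasure_gibbs lam hf
  by_cases hP0 : gibbs lam f P = 0
  · simp [partDivergence, measureReal_def, hP0, Measure.restrict_eq_zero.2 hP0]
  have := cond_isProbabilityMeasure hP0
  have hPpos : 0 < (gibbs lam f).real P := ENNReal.toReal_pos hP0 (measure_ne_top _ _)
  have hcond : ∫ x, dtcDefect lam star f x ∂(gibbs lam f)[|P]
      = ((gibbs lam f).real P)⁻¹ * ∫ x in P, dtcDefect lam star f x ∂gibbs lam f := by
    rw [ProbabilityTheory.cond, integral_smul_measure, ENNReal.toReal_inv, smul_eq_mul,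
      measureReal_def]
  have heq : partDivergence lam star f P = (gibbs lam f).real P
      * ∫ y, condDivergence lam star f P y ∂(gibbs lam f)[|P] := by
    rw [integral_condDivergence lam hf hP0, hcond, partDivergence, Real.negMulLog]
    field_simp
  have hnn := condDivergence_nonneg lam (star := star) hf hP hP0
  constructor
  · simp only [klDiv_cond_gibbs lam hf hP hP0]
    rw [← ofReal_integral_eq_lintegral_ofReal
      ((boundedMeasurable_condDivergence lam hf hP0).integrable _)
      (Filter.Eventually.of_forall hnn), heq, ENNReal.ofReal_mul hPpos.le, measureReal_def,
      ENNReal.ofReal_toReal (measure_ne_top _ _)]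
  · rw [heq]
    exact mul_nonneg hPpos.le (integral_nonneg hnn)

/-- The sum over the partition of the divergences, together with the dual total correlation, is
the entropy of the partition plus an average of the variation of the discrete gradient. -/
theorem sum_divergence_add_dtcFunctional_lt (hf : BoundedMeasurable f)
    {parts : Set (Set (∀ i, K i))} (hpart : Setoid.IsPartition parts) (hcount : parts.Countable)
    (hmeas : ∀ P ∈ parts, MeasurableSet P)
    (hent : partitionEntropy (gibbs lam f) parts ≠ ∞) {s : ℝ}
    (hs : ∀ P ∈ parts, ∀ x ∈ P, ∀ y ∈ P,
      |discreteGradient star f x x - discreteGradient star f y x| < s) :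
    ∃ A, 0 ≤ A ∧ ∑' P : parts, gibbs lam f (P : Set (∀ i, K i)) *
        ∫⁻ y, klDiv ((gibbs lam f)[|(P : Set (∀ i, K i))])
          (gibbs lam (discreteGradient star f y)) ∂(gibbs lam f)[|(P : Set (∀ i, K i))]
        = ENNReal.ofReal A ∧
      A + dtcFunctional lam (fun x => Real.exp (f x) / ∫ z, Real.exp (f z) ∂Measure.pi lam)
        < (partitionEntropy (gibbs lam f) parts).toReal + s := by
  have := isProbabilityMeasure_gibbs lam hf
  have : Countable parts := hcount.to_subtype
  set μ := gibbs lam f with hμ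
  have hm : ∀ P : parts, MeasurableSet (P : Set (∀ i, K i)) := fun P => hmeas P P.2
  have hd : Pairwise (Function.onFun Disjoint fun P : parts => (P : Set (∀ i, K i))) :=
    fun P Q hPQ => hpart.pairwiseDisjoint P.2 Q.2 (Subtype.coe_ne_coe.2 hPQ)
  have hU : (⋃ P : parts, (P : Set (∀ i, K i))) = Set.univ := by
    rw [← Set.sUnion_eq_iUnion]
    exact hpart.sUnion_eq_univ
  have hsumint : ∀ φ, BoundedMeasurable φ →
      HasSum (fun P : parts => ∫ x in (P : Set (∀ i, K i)), φ x ∂μ) (∫ x, φ x ∂μ) := by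
    intro φ hφ
    have h := hasSum_integral_iUnion hm hd (hφ.integrable μ).integrableOn
    rwa [hU, setIntegral_univ] at h
  have hmass : HasSum (fun P : parts => μ.real (P : Set (∀ i, K i))) 1 := by
    simpa using hsumint _ (.const 1)
  have hT := hsumint _ (boundedMeasurable_dtcDefect lam (star := star) hf)
  have hneg : ∀ P : parts, 0 ≤ Real.negMulLog (μ.real (P : Set (∀ i, K i))) := fun P =>
    Real.negMulLog_nonneg measureReal_nonneg measureReal_le_one
  have hHs : Summable fun P : parts => Real.negMulLog (μ.real (P : Set (∀ i, K i))) := by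
    have h := ENNReal.summable_toReal hent
    simpa only [ENNReal.toReal_ofReal (hneg _)] using h
  have hH : HasSum (fun P : parts => Real.negMulLog (μ.real (P : Set (∀ i, K i))))
      (partitionEntropy μ parts).toReal := by
    rw [partitionEntropy, ← ENNReal.ofReal_tsum_of_nonneg hneg hHs,
      ENNReal.toReal_ofReal (tsum_nonneg hneg)]
    exact hHs.hasSum
  -- the errors are at most `s`, and strictly less on parts of positive mass
  have hzero : ∀ P : parts, μ (P : Set (∀ i, K i)) = 0 → μ.real (P : Set (∀ i, K i)) = 0 :=
    fun P hP => by rw [measureReal_def, hP, ENNReal.toReal_zero]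
  have herr : ∀ P : parts, |μ.real (P : Set (∀ i, K i)) * gradientError lam star f P|
      ≤ μ.real (P : Set (∀ i, K i)) * s := by
    intro P
    by_cases hP0 : μ (P : Set (∀ i, K i)) = 0
    · simp [hzero P hP0]
    · rw [abs_mul, abs_of_nonneg measureReal_nonneg]
      exact mul_le_mul_of_nonneg_left
        (abs_gradientError_lt lam hf (hm P) hP0 (hs P P.2)).le measureReal_nonneg
  have hEs : Summable fun P : parts =>
      μ.real (P : Set (∀ i, K i)) * gradientError lam star f P :=
    Summable.of_norm_bounded (hmass.summable.mul_right s) herr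
  obtain ⟨P₀, hP₀⟩ : ∃ P : parts, μ (P : Set (∀ i, K i)) ≠ 0 := by
    by_contra! h
    have : μ Set.univ = 0 := by
      rw [← hU]
      exact measure_iUnion_null h
    simp at this
  have hElt : ∑' P : parts, μ.real (P : Set (∀ i, K i)) * gradientError lam star f P < s := by
    have h1 : HasSum (fun P : parts => μ.real (P : Set (∀ i, K i)) * s) s := by
      simpa using hmass.mul_right s
    refine hasSum_lt (i := P₀) (fun P => (le_abs_self _).trans (herr P)) ?_ hEs.hasSum h1
    exact mul_lt_mul_of_pos_left ((le_abs_self _).trans_lt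
      (abs_gradientError_lt lam hf (hm P₀) hP₀ (hs P₀ P₀.2)))
      (ENNReal.toReal_pos hP₀ (measure_ne_top _ _))
  have hA := (hH.add hT).add hEs.hasSum
  have hnn : ∀ P : parts, 0 ≤ partDivergence lam star f P := fun P =>
    (lintegral_klDiv_cond lam hf (hm P)).2
  change HasSum (fun P : parts => partDivergence lam star f P) _ at hA
  refine ⟨_, hA.nonneg hnn, ?_, ?_⟩
  · simp only [hμ, (lintegral_klDiv_cond lam hf (hm _)).1]
    rw [← ENNReal.ofReal_tsum_of_nonneg hnn hA.summable, hA.tsum_eq]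
  · rw [dtcFunctional_gibbs lam star hf, ← hμ]
    linarith

end

section

variable {n : ℕ} {K : Fin n → Type*} [∀ i, MetricSpace (K i)] [∀ i, MeasurableSpace (K i)]
  [∀ i, TopologicalSpace.SeparableSpace (K i)] [∀ i, BorelSpace (K i)] [∀ i, CompleteSpace (K i)]
  (lam : ∀ i, Measure (K i)) [∀ i, IsProbabilityMeasure (lam i)]
  {star : ∀ i, K i} {f : (∀ i, K i) → ℝ}

theorem transportDist_cond_gibbs_le (hdiam : ∀ i, ∀ a b : K i, dist a b ≤ 1) (hn : 0 < n)
    (hf : BoundedMeasurable f) {P : Set (∀ i, K i)} (hP : MeasurableSet P)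
    (hP0 : gibbs lam f P ≠ 0) (y : ∀ i, K i) {c : ℝ} (hc : 0 < c) :
    transportDist ((gibbs lam f)[|P]) (gibbs lam (discreteGradient star f y))
      ≤ klDiv ((gibbs lam f)[|P]) (gibbs lam (discreteGradient star f y))
          * ENNReal.ofReal (1 / (4 * c * n)) + ENNReal.ofReal (c / 2) := by
  have : ∀ i, Nonempty (K i) := fun i => ⟨star i⟩
  have := isProbabilityMeasure_tilted_discretePartial lam (star := star) hf y
  have hD := condDivergence_nonneg lam (star := star) hf hP hP0 y
  have hn' : (0 : ℝ) < n := Nat.cast_pos.2 hn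
  have h := transportDist_densityMeasure_le hdiam hn
    (boundedMeasurable_condDensity (star := star) lam hf hP y) (condDensity_nonneg lam P y) (integral_condDensity lam hf hP hP0 y) hc
  rw [← cond_gibbs_eq lam hf hP hP0 y, ← gibbs_discreteGradient lam hf y,
    entropyInt_condDensity lam hf hP hP0 y] at h
  rw [klDiv_cond_gibbs lam hf hP hP0 y, ← ENNReal.ofReal_mul hD,
    ← ENNReal.ofReal_add (by positivity) (by positivity)]
  refine h.trans_eq ?_
  congr 1
  ring

theorem sum_transportDist_le (hdiam : ∀ i, ∀ a b : K i, dist a b ≤ 1) (hn : 0 < n)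
    (hf : BoundedMeasurable f) {parts : Set (Set (∀ i, K i))} (hpart : Setoid.IsPartition parts)
    (hcount : parts.Countable) (hmeas : ∀ P ∈ parts, MeasurableSet P) {c : ℝ} (hc : 0 < c) :
    ∑' P : parts, gibbs lam f (P : Set (∀ i, K i)) *
        ∫⁻ y, transportDist ((gibbs lam f)[|(P : Set (∀ i, K i))])
          (gibbs lam (discreteGradient star f y)) ∂(gibbs lam f)[|(P : Set (∀ i, K i))]
      ≤ (∑' P : parts, gibbs lam f (P : Set (∀ i, K i)) *
          ∫⁻ y, klDiv ((gibbs lam f)[|(P : Set (∀ i, K i))])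
            (gibbs lam (discreteGradient star f y)) ∂(gibbs lam f)[|(P : Set (∀ i, K i))])
          * ENNReal.ofReal (1 / (4 * c * n)) + ENNReal.ofReal (c / 2) := by
  have := isProbabilityMeasure_gibbs lam hf
  have : Countable parts := hcount.to_subtype
  have hmass : ∑' P : parts, gibbs lam f (P : Set (∀ i, K i)) = 1 := by
    have hd : Pairwise (Function.onFun Disjoint fun P : parts => (P : Set (∀ i, K i))) :=
      fun P Q hPQ => hpart.pairwiseDisjoint P.2 Q.2 (Subtype.coe_ne_coe.2 hPQ)
    rw [← measure_iUnion hd fun P => hmeas P P.2,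
      ← Set.sUnion_eq_iUnion, hpart.sUnion_eq_univ, measure_univ]
  calc _ ≤ ∑' P : parts, ((gibbs lam f (P : Set (∀ i, K i)) *
          ∫⁻ y, klDiv ((gibbs lam f)[|(P : Set (∀ i, K i))])
            (gibbs lam (discreteGradient star f y)) ∂(gibbs lam f)[|(P : Set (∀ i, K i))])
          * ENNReal.ofReal (1 / (4 * c * n))
          + gibbs lam f (P : Set (∀ i, K i)) * ENNReal.ofReal (c / 2)) := by
        refine ENNReal.tsum_le_tsum fun P => ?_
        by_cases hP0 : gibbs lam f (P : Set (∀ i, K i)) = 0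
        · simp [hP0]
        have := cond_isProbabilityMeasure hP0
        rw [mul_assoc, ← mul_add]
        gcongr
        refine (lintegral_mono fun y => transportDist_cond_gibbs_le lam hdiam hn hf
          (hmeas P P.2) hP0 y hc).trans_eq ?_
        rw [lintegral_add_right _ measurable_const, lintegral_const, measure_univ, mul_one,
          lintegral_mul_const' _ _ ENNReal.ofReal_ne_top]
    _ = _ := by
        rw [ENNReal.tsum_add, ENNReal.tsum_mul_right, ENNReal.tsum_mul_right, hmass, one_mul]

end

end GibbsMixture

theorem theoremA {n : ℕ} {K : Fin n → Type*}
    [∀ i, MetricSpace (K i)] [∀ i, CompleteSpace (K i)]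
    [∀ i, TopologicalSpace.SeparableSpace (K i)]
    [∀ i, MeasurableSpace (K i)] [∀ i, BorelSpace (K i)]
    (hdiam : ∀ i, ∀ a b : K i, dist a b ≤ 1)
    (lam : ∀ i, Measure (K i)) [∀ i, IsProbabilityMeasure (lam i)]
    (star : ∀ i, K i) (f : (∀ i, K i) →ᵇ ℝ)
    (μ : Measure (∀ i, K i)) (hμ : μ = GibbsMixture.gibbs lam f)
    (parts : Set (Set (∀ i, K i))) (hpart : Setoid.IsPartition parts) (hcount : parts.Countable)
    (hmeas : ∀ P ∈ parts, MeasurableSet P) (hent : GibbsMixture.partitionEntropy μ parts ≠ ∞)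
    (δ : ℝ)
    (hsmall : ∀ P ∈ parts, ∀ x ∈ P, ∀ y ∈ P,
      (⨆ z : ∀ i, K i, |GibbsMixture.discreteGradient star f x z
        - GibbsMixture.discreteGradient star f y z|) < δ * n) :
    GibbsMixture.DTC μ <
        (GibbsMixture.partitionEntropy μ parts : EReal) + ((δ * n : ℝ) : EReal) ∧
    (∑' P : parts, μ (P : Set (∀ i, K i)) *
        ∫⁻ y, klDiv (μ[|(P : Set (∀ i, K i))])
            (GibbsMixture.gibbs lam (GibbsMixture.discreteGradient star f y))
          ∂(μ[|(P : Set (∀ i, K i))])) <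
        GibbsMixture.partitionEntropy μ parts + ENNReal.ofReal (δ * n) ∧
    (∑' P : parts, μ (P : Set (∀ i, K i)) *
        ∫⁻ y, GibbsMixture.transportDist (μ[|(P : Set (∀ i, K i))])
            (GibbsMixture.gibbs lam (GibbsMixture.discreteGradient star f y))
          ∂(μ[|(P : Set (∀ i, K i))])) <
        ENNReal.ofReal
          (√(1 / 2 * ((GibbsMixture.partitionEntropy μ parts).toReal / n + δ))) := by
  open GibbsMixture in
  subst hμ
  have : ∀ i, SecondCountableTopology (K i) := fun i =>
    UniformSpace.secondCountable_of_separable (K i)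
  have hf : BoundedMeasurable (f : (∀ i, K i) → ℝ) :=
    ⟨f.continuous.measurable, ‖f‖, fun x => f.norm_coe_le_norm x⟩
  have hprob := isProbabilityMeasure_gibbs lam hf
  -- the supremum over `z` is attained by a bounded family, so it bounds each of its members
  have hs : ∀ P ∈ parts, ∀ x ∈ P, ∀ y ∈ P,
      |discreteGradient star f x x - discreteGradient star f y x| < δ * n := by
    intro P hP x hx y hy
    refine lt_of_le_of_lt ?_ (hsmall P hP x hx y hy)
    obtain ⟨-, C, hC⟩ := (boundedMeasurable_discreteGradient_right (star := star) hf x).sub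
      (boundedMeasurable_discreteGradient_right (star := star) hf y)
    exact le_ciSup (f := fun z => |discreteGradient star f x z - discreteGradient star f y z|)
      ⟨C, by rintro _ ⟨z, rfl⟩; exact hC z⟩ x
  have hδn : 0 < δ * n := by
    obtain ⟨P, ⟨hP, hx⟩, -⟩ := hpart.2 star
    exact (abs_nonneg _).trans_lt (hs P hP star hx star hx)
  have hn : 0 < n := by
    rcases Nat.eq_zero_or_pos n with h | h
    · simp [h] at hδn
    · exact h
  have hn' : (0 : ℝ) < n := Nat.cast_pos.2 hn
  have hδ : 0 < δ := pos_of_mul_pos_left hδn hn'.le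
  obtain ⟨A, hA0, hAsum, hAlt⟩ :=
    sum_divergence_add_dtcFunctional_lt lam hf hpart hcount hmeas hent hs
  set H := (partitionEntropy (gibbs lam f) parts).toReal with hH
  have hH0 : 0 ≤ H := ENNReal.toReal_nonneg
  have hHeq : partitionEntropy (gibbs lam f) parts = ENNReal.ofReal H :=
    (ENNReal.ofReal_toReal hent).symm
  obtain ⟨c, hc, hcp⟩ := exists_le_gibbsDensity lam hf
  have bp := boundedMeasurable_gibbsDensity lam hf
  have hdtc0 := dtcFunctional_nonneg (fun φ _ => integral_gibbs lam hf φ) bp hc hcp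
  refine ⟨?_, ?_, ?_⟩
  · have hle : DTC (gibbs lam f) ≤ ((dtcFunctional lam fun x =>
        Real.exp (f x) / ∫ z, Real.exp (f z) ∂Measure.pi lam : ℝ) : EReal) :=
      iSup_le fun k => iSup_le fun q => iSup_le fun hq => EReal.coe_le_coe_iff.2
        (finiteDTC_le (fun φ _ => integral_gibbs lam hf φ) (tilted_absolutelyContinuous _ _)
          bp hc hcp hq)
    refine hle.trans_lt ?_
    rw [← EReal.coe_ennreal_toReal hent, ← EReal.coe_add, EReal.coe_lt_coe_iff]
    linarith
  · rw [hAsum, hHeq, ← ENNReal.ofReal_add hH0 hδn.le,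
      ENNReal.ofReal_lt_ofReal_iff (by positivity)]
    linarith
  · set c := √(1 / 2 * (H / n + δ)) with hcdef
    have hc : 0 < c := Real.sqrt_pos.2 (by positivity)
    have hc2 : c ^ 2 = 1 / 2 * (H / n + δ) := Real.sq_sqrt (by positivity)
    refine (sum_transportDist_le lam hdiam hn hf hpart hcount hmeas hc).trans_lt ?_
    rw [hAsum, ← ENNReal.ofReal_mul hA0, ← ENNReal.ofReal_add (by positivity) (by positivity),
      ENNReal.ofReal_lt_ofReal_iff hc]
    have hAc : A < 2 * c ^ 2 * n := by
      have : 2 * c ^ 2 * n = H + δ * n := by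
        rw [hc2]
        field_simp
      linarith
    have h1 : A * (1 / (4 * c * n)) < c / 2 := by
      rw [mul_one_div, div_lt_iff₀ (by positivity)]
      nlinarith
    linarith
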